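/- Let $s\ge 6$ and $d\ge 1$ be integers. Let $a_1=0,a_2,\dots,a_s$ be pairwise distinct integers such that the greatest common divisor of the nonzero ones is $1$, and let $\mathcal B_1,\dots,\mathcal B_s$ be nonempty subsets of $\mathbb Z/d\mathbb Z$ with $0\in\mathcal B_1$. Put $$\tilde{\mathcal B}=\bigcup_{i=1}^s \{a_i\}\times\mathcal B_i\subset \mathbb Z\times\mathbb Z/d\mathbb Z ,\qquad \tilde{\mathcal B}+\tilde{\mathcal B}=\{u+v: u,v\in\tilde{\mathcal B}\},$$ and suppose that $|\tilde{\mathcal B}+\tilde{\mathcal B}|<2.5\,|\tilde{\mathcal B}|$. Then $\max_i a_i<1.5\,s$, and there exist a subgroup $\tilde{\mathcal H}$ of $\mathbb Z/d\mathbb Z$ and elements $x,y\in\mathbb Z/d\mathbb Z$ such that $\mathcal B_i\subset a_ix+y+\tilde{\mathcal H}$ for every $i$. Further, for this same subgroup, $|\mathcal B_j|\ge\frac23|\tilde{\mathcal H}|$ for some $j$ with $1\le j\le s$, and $$\bigl(\max_i a_i\bigr)\,|\tilde{\mathcal H}|\le|\tilde{\mathcal B}+\tilde{\mathcal B}|-|\tilde{\mathcal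 B}| .$$ -/

import Mathlib

open scoped Pointwise

/-- The set `⋃ i, {a i} × B i` in `ℤ × ℤ/dℤ`. -/
def fiberUnion {s d : ℕ} (a : Fin s → ℤ) (B : Fin s → Finset (ZMod d)) :
    Finset (ℤ × ZMod d) :=
  Finset.univ.biUnion fun i => {a i} ×ˢ B i

/-
Translate the set `B ⊂ ℤ × G` so that its lowest fibre lies over `0` and contains `0`, and let `g`
be a point of its highest fibre. Kneser's theorem in `(ℤ × G) / ⟨g⟩` gives a subgroup `K`
containing `g` such that the image `D` of `B` modulo `K` satisfies `|D + D| ≥ 2|D| - 1` and `B + B`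
has at least `|D + D| ℓ h` elements modulo `g`; here `h` is the order of the part of `K` over `0`,
and `ℓ` is the number of integers in `[0, g.1)` over which `K` has an element. Since `B` and `B + g`
both lie in `B + B`, at least `∑ max(|Bᵢ|, |M|)` elements are lost modulo `g`, where the `Bᵢ` are
the fibres of `B` and `M` is the part of `B ∩ (B - g)` over `0`.

With doubling below `5 / 2` this leaves `|D| ≤ 4`; counting fibres, and applying Kneser's theorem to
the sums of two classes of `B` modulo `K`, excludes `|D| = 2, 3, 4`. So `B ⊂ K`, and the gcd
condition makes `K` surject onto `ℤ`, which gives the cosets and the bound `L h ≤ |B + B| - |B|`,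
where `L = g.1`. If every fibre had density below `2 / 3` in its coset, then by pigeonhole all
fibres of `B + B` over `3, …, 2L - 3` would be full, and `B + B` would be too large.
-/

open Finset AddAction

section Kneser

variable {G : Type*} [AddCommGroup G]

lemma card_le_natCard_of_sub_mem {S : AddSubgroup G} [Finite S] {X : Finset G} (c : G)
    (h : ∀ x ∈ X, x - c ∈ S) : #X ≤ Nat.card S := by
  rw [← Nat.card_eq_finsetCard]
  exact Nat.card_le_card_of_injective (fun x : X => (⟨x - c, h x x.2⟩ : S))
    fun x y hxy => Subtype.ext (sub_left_injective (congrArg Subtype.val hxy))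

lemma exists_finset_mem_iff_sub_mem (S : AddSubgroup G) [Finite S] (c : G) :
    ∃ P : Finset G, (∀ x, x ∈ P ↔ x - c ∈ S) ∧ #P = Nat.card S := by
  classical
  have := Fintype.ofFinite S
  refine ⟨univ.image fun s : S => s + c, fun x => ?_, ?_⟩
  · simp only [mem_image, mem_univ, true_and]
    exact ⟨fun ⟨s, hs⟩ => by simp [← hs], fun hx => ⟨⟨x - c, hx⟩, by simp⟩⟩
  · rw [card_image_of_injective _ fun s t hst => by simpa using hst, card_univ,
      Nat.card_eq_fintype_card]

lemma card_add_card_le_of_sub_mem {S T : AddSubgroup G} [Finite S] {X Y Z : Finset G} (c : G)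
    (hXZ : X ⊆ Z) (hYZ : Y ⊆ Z) (hX : ∀ x ∈ X, x - c ∈ S) (hY : ∀ y ∈ Y, y - c ∈ T) :
    #X + #Y ≤ #Z + Nat.card (S ⊓ T : AddSubgroup G) := by
  classical
  have : Finite (S ⊓ T : AddSubgroup G) := Finite.Set.finite_inter_of_left (S : Set G) T
  rw [← card_union_add_card_inter]
  refine add_le_add (card_le_card (union_subset hXZ hYZ))
    (card_le_natCard_of_sub_mem c fun z hz => ?_)
  exact ⟨hX z (mem_inter.1 hz).1, hY z (mem_inter.1 hz).2⟩

variable [DecidableEq G]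

lemma finite_stabilizer_of_nonempty {C : Finset G} (hC : C.Nonempty) :
    Finite (stabilizer G C) := by
  rw [← stabilizer_coe_finset]
  exact stabilizer_finite hC C.finite_toSet

lemma card_inter_add_card_sdiff_le_of_sub_mem_stabilizer {C₁ C₂ P Q : Finset G} {x g₁ g₂ : G}
    [Finite (stabilizer G C₁)] (hP : ∀ p ∈ P, p - x ∈ stabilizer G C₁)
    (hQ : ∀ q ∈ Q, q - x ∈ stabilizer G C₂) (hg₁ : g₁ ∈ P) (hg₁C : g₁ ∈ C₂) (hg₂ : g₂ ∈ Q)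
    (hg₂C : g₂ ∉ C₁) :
    #(P ∩ C₂) + #(Q \ C₁) ≤
      #(C₂ \ C₁) + Nat.card (stabilizer G C₁ ⊓ stabilizer G C₂ : AddSubgroup G) := by
  have hP_add : ∀ p ∈ P, ∀ q, p - x + q ∈ C₁ ↔ q ∈ C₁ := fun p hp =>
    mem_stabilizer_finset.1 (hP p hp)
  have hQ_add : ∀ p ∈ Q, ∀ q, p - x + q ∈ C₂ ↔ q ∈ C₂ := fun p hp =>
    mem_stabilizer_finset.1 (hQ p hp)
  rw [← card_vadd_finset (g₂ - x) (P ∩ C₂), ← card_vadd_finset (g₁ - x) (Q \ C₁)]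
  refine card_add_card_le_of_sub_mem (g₁ + g₂ - x) ?_ ?_ ?_ ?_ <;> intro y hy <;>
    obtain ⟨z, hz, rfl⟩ := mem_vadd_finset.1 hy <;> rw [vadd_eq_add]
  · obtain ⟨hzP, hzC⟩ := mem_inter.1 hz
    refine mem_sdiff.2 ⟨(hQ_add g₂ hg₂ z).2 hzC, fun h => hg₂C ((hP_add z hzP g₂).1 ?_)⟩
    convert h using 1; abel
  · obtain ⟨hzQ, hzC⟩ := mem_sdiff.1 hz
    refine mem_sdiff.2 ⟨?_, fun h => hzC ((hP_add g₁ hg₁ z).1 h)⟩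
    convert (hQ_add z hzQ g₁).2 hg₁C using 1; abel
  · convert sub_mem (hP z (mem_inter.1 hz).1) (hP g₁ hg₁) using 1; abel
  · convert sub_mem (hQ z (mem_sdiff.1 hz).1) (hQ g₂ hg₂) using 1; abel

/- Compare the cosets of the two stabilizers through `x`: that of `stabilizer G C₁` lies in `C₁`,
and that of `stabilizer G C₂` is disjoint from `C₂`. -/
lemma card_stabilizer_add_card_stabilizer_le {C₁ C₂ : Finset G} {x : G} (hx₁ : x ∈ C₁)
    (hx₂ : x ∉ C₂) (hC₂ : C₂.Nonempty) :
    Nat.card (stabilizer G C₁) + Nat.card (stabilizer G C₂) ≤ #(C₁ \ C₂) + #(C₂ \ C₁) +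
        2 * Nat.card (stabilizer G C₁ ⊓ stabilizer G C₂ : AddSubgroup G) ∨
      Nat.card (stabilizer G C₁) ≤ #(C₁ \ C₂) ∨ Nat.card (stabilizer G C₂) ≤ #(C₁ \ C₂) := by
  have := finite_stabilizer_of_nonempty ⟨x, hx₁⟩
  have := finite_stabilizer_of_nonempty hC₂
  obtain ⟨P, hP, hPcard⟩ := exists_finset_mem_iff_sub_mem (stabilizer G C₁) x
  obtain ⟨Q, hQ, hQcard⟩ := exists_finset_mem_iff_sub_mem (stabilizer G C₂) x
  have hPC : P ⊆ C₁ := fun y hy => by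
    simpa using (mem_stabilizer_finset.1 ((hP y).1 hy) x).2 hx₁
  have hQC : ∀ y ∈ Q, y ∉ C₂ := fun y hy => by
    simpa using mt (mem_stabilizer_finset.1 ((hQ y).1 hy) x).1 hx₂
  by_cases hg₁ : ∃ g ∈ P, g ∈ C₂
  swap
  · push Not at hg₁
    exact .inr <| .inl <| hPcard ▸ card_le_card fun y hy => mem_sdiff.2 ⟨hPC hy, hg₁ y hy⟩
  by_cases hg₂ : ∃ g ∈ Q, g ∉ C₁
  swap
  · push Not at hg₂
    exact .inr <| .inr <| hQcard ▸ card_le_card fun y hy => mem_sdiff.2 ⟨hg₂ y hy, hQC y hy⟩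
  obtain ⟨g₁, hg₁, hg₁C⟩ := hg₁
  obtain ⟨g₂, hg₂, hg₂C⟩ := hg₂
  have hle₁ : #(P \ C₂) + #(Q ∩ C₁) ≤ #(C₁ \ C₂) +
      Nat.card (stabilizer G C₁ ⊓ stabilizer G C₂ : AddSubgroup G) := by
    refine card_add_card_le_of_sub_mem x (sdiff_subset_sdiff hPC subset_rfl)
      (fun y hy => ?_) (fun y hy => (hP y).1 (mem_sdiff.1 hy).1)
      fun y hy => (hQ y).1 (mem_inter.1 hy).1
    exact mem_sdiff.2 ⟨(mem_inter.1 hy).2, hQC y (mem_inter.1 hy).1⟩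
  have hle₂ := card_inter_add_card_sdiff_le_of_sub_mem_stabilizer (fun p => (hP p).1)
    (fun q => (hQ q).1) hg₁ hg₁C hg₂ hg₂C
  have hPsplit := card_sdiff_add_card_inter P C₂
  have hQsplit := card_sdiff_add_card_inter Q C₁
  left
  omega

lemma le_card_union_add_card_stabilizer {C₁ C₂ : Finset G} {t : ℕ} (hC₁ : C₁.Nonempty)
    (hC₂ : C₂.Nonempty) (h₁ : t ≤ #C₁ + Nat.card (stabilizer G C₁))
    (h₂ : t ≤ #C₂ + Nat.card (stabilizer G C₂)) :
    t ≤ #(C₁ ∪ C₂) + Nat.card (stabilizer G (C₁ ∪ C₂)) := by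
  by_cases h12 : C₁ ⊆ C₂
  · rwa [union_eq_right.2 h12]
  by_cases h21 : C₂ ⊆ C₁
  · rwa [union_eq_left.2 h21]
  obtain ⟨x, hx₁, hx₂⟩ := not_subset.1 h12
  obtain ⟨y, hy₂, hy₁⟩ := not_subset.1 h21
  have hinf : Nat.card (stabilizer G C₁ ⊓ stabilizer G C₂ : AddSubgroup G) ≤
      Nat.card (stabilizer G (C₁ ∪ C₂)) := by
    have := finite_stabilizer_of_nonempty (hC₁.mono (subset_union_left (s₂ := C₂)))
    refine AddSubgroup.card_le_of_le ?_
    simpa only [← stabilizer_coe_finset, coe_union] using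
      stabilizer_inf_stabilizer_le_stabilizer_union (G := G) (s := (C₁ : Set G)) (t := C₂)
  have hx := card_stabilizer_add_card_stabilizer_le hx₁ hx₂ hC₂
  have hy := card_stabilizer_add_card_stabilizer_le hy₂ hy₁ hC₁
  rw [inf_comm] at hy
  have h21_card := card_sdiff_add_card C₂ C₁
  have h12_card := card_sdiff_add_card C₁ C₂
  rw [union_comm] at h21_card
  omega

lemma exists_subset_add_mem_card_add_card_le (a b : G) {A B : Finset G} (ha : a ∈ A)
    (hb : b ∈ B) :
    ∃ C ⊆ A + B, a + b ∈ C ∧ #A + #B ≤ #C + Nat.card (stabilizer G C) := by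
  induction hn : #B using Nat.strong_induction_on generalizing A B with
  | _ n ih =>
  by_cases h : ∀ e ∈ A, ∀ y ∈ B, y - b + e ∈ A
  · refine ⟨b +ᵥ A, fun x hx => ?_, ?_, ?_⟩
    · obtain ⟨y, hy, rfl⟩ := mem_vadd_finset.1 hx
      rw [vadd_eq_add, add_comm b]
      exact add_mem_add hy hb
    · rw [add_comm]
      exact vadd_mem_vadd_finset ha
    · have := finite_stabilizer_of_nonempty ⟨a, ha⟩
      rw [card_vadd_finset, stabilizer_vadd_eq_right, ← hn]
      exact Nat.add_le_add_left (card_le_natCard_of_sub_mem b fun y hy =>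
        mem_stabilizer_finset'.2 fun e he => h e he y hy) _
  · push Not at h
    obtain ⟨e, he, y, hy, hey⟩ := h
    have ha' : a ∈ (addDysonETransform (e - b) (A, B)).1 := mem_union_left _ ha
    have hb' : b ∈ (addDysonETransform (e - b) (A, B)).2 :=
      mem_inter.2 ⟨hb, mem_vadd_finset.2 ⟨e, he, by simp⟩⟩
    have hlt : #(addDysonETransform (e - b) (A, B)).2 < n := by
      refine hn ▸ card_lt_card ⟨inter_subset_left, fun hs => hey ?_⟩
      obtain ⟨z, hz, rfl⟩ := mem_vadd_finset.1 (mem_inter.1 (hs hy)).2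
      simpa [sub_add_eq_add_sub] using hz
    obtain ⟨C, hC, habC, hle⟩ := ih _ hlt ha' hb' rfl
    have hcard := addDysonETransform.card (e - b) (A, B)
    exact ⟨C, hC.trans (addDysonETransform.subset _ (A, B)), habC, by lia⟩

/- Kneser's theorem by Dyson's transform: the subsets `C` of `A + B` with
`#A + #B ≤ #C + #(stabilizer C)` cover `A + B` and are closed under unions. -/
theorem card_add_card_le_card_add_add_card_stabilizer {A B : Finset G} (hA : A.Nonempty)
    (hB : B.Nonempty) :
    #A + #B ≤ #(A + B) + Nat.card (stabilizer G (A + B)) := by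
  suffices H : ∀ T : Finset G, T.Nonempty → T ⊆ A + B →
      ∃ C ⊆ A + B, T ⊆ C ∧ #A + #B ≤ #C + Nat.card (stabilizer G C) by
    obtain ⟨C, hC, hC', h⟩ := H (A + B) (hA.add hB) subset_rfl
    rwa [hC.antisymm hC'] at h
  have hpoint : ∀ c ∈ A + B, ∃ C ⊆ A + B, c ∈ C ∧ #A + #B ≤ #C + Nat.card (stabilizer G C) := by
    intro c hc
    obtain ⟨a, ha, b, hb, rfl⟩ := mem_add.1 hc
    exact exists_subset_add_mem_card_add_card_le a b ha hb
  intro T hT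
  induction hT using Finset.Nonempty.cons_induction with
  | singleton c => simpa using hpoint c
  | cons c T hcT hT ih =>
    intro hTsub
    rw [cons_eq_insert] at hTsub ⊢
    rw [insert_subset_iff] at hTsub
    obtain ⟨C₁, hC₁, hTC₁, h₁⟩ := ih hTsub.2
    obtain ⟨C₂, hC₂, hcC₂, h₂⟩ := hpoint c hTsub.1
    refine ⟨C₁ ∪ C₂, union_subset hC₁ hC₂, ?_,
      le_card_union_add_card_stabilizer (hT.mono hTC₁) ⟨c, hcC₂⟩ h₁ h₂⟩
    exact insert_subset_iff.2 ⟨mem_union_right _ hcC₂, hTC₁.trans subset_union_left⟩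

lemma stabilizer_image_mk_eq_bot (X : Finset G) [DecidableEq (G ⧸ stabilizer G X)] :
    stabilizer (G ⧸ stabilizer G X) (X.image (QuotientAddGroup.mk' (stabilizer G X))) = ⊥ := by
  have hquot : ∀ H : AddSubgroup G, H = stabilizer G (X : Set G) →
      stabilizer (G ⧸ H) (QuotientAddGroup.mk' H '' X) = ⊥ := by
    rintro _ rfl
    exact stabilizer_image_coe_quotient (s := (X : Set G))
  refine (stabilizer_coe_finset _).symm.trans ?_
  rw [coe_image]
  exact hquot _ (stabilizer_coe_finset X).symm

theorem card_image_mk_add_card_image_mk_le {A B : Finset G} (hA : A.Nonempty) (hB : B.Nonempty)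
    [DecidableEq (G ⧸ stabilizer G (A + B))] :
    #(A.image (QuotientAddGroup.mk' (stabilizer G (A + B)))) +
        #(B.image (QuotientAddGroup.mk' (stabilizer G (A + B)))) ≤
      #((A + B).image (QuotientAddGroup.mk' (stabilizer G (A + B)))) + 1 := by
  have h := card_add_card_le_card_add_add_card_stabilizer
    (hA.image (QuotientAddGroup.mk' (stabilizer G (A + B))))
    (hB.image (QuotientAddGroup.mk' (stabilizer G (A + B))))
  rwa [← image_add, stabilizer_image_mk_eq_bot, AddSubgroup.card_bot] at h

lemma card_eq_card_image_mk_mul_card_stabilizer {X : Finset G} (hX : X.Nonempty)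
    [DecidableEq (G ⧸ stabilizer G X)] :
    #X = #(X.image (QuotientAddGroup.mk' (stabilizer G X))) * Nat.card (stabilizer G X) := by
  have := finite_stabilizer_of_nonempty hX
  rw [card_eq_sum_card_image (QuotientAddGroup.mk' (stabilizer G X)) X]
  refine sum_const_nat fun q hq => ?_
  obtain ⟨x, hx, rfl⟩ := mem_image.1 hq
  obtain ⟨P, hP, hPcard⟩ := exists_finset_mem_iff_sub_mem (stabilizer G X) x
  rw [← hPcard]
  congr 1
  ext y
  rw [mem_filter, hP, QuotientAddGroup.mk'_apply, QuotientAddGroup.mk'_apply, eq_comm,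
    QuotientAddGroup.eq, ← sub_eq_neg_add]
  exact and_iff_right_of_imp fun hy => by simpa using (mem_stabilizer_finset.1 hy x).2 hx

end Kneser

section Fibers

variable {G Γ : Type*} [AddCommGroup G] [AddCommGroup Γ] {ρ : ℤ × G →+ Γ}

/-- The elements `x` of `G` with `(0, x) ∈ K`: the part of a subgroup `K` of `ℤ × G` lying over
`0`. -/
def verticalPart (K : AddSubgroup (ℤ × G)) : AddSubgroup G :=
  K.comap (AddMonoidHom.inr ℤ G)

open scoped Classical in
/-- The integers in `[0, L)` over which the subgroup `K` of `ℤ × G` has an element. -/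
noncomputable def levels (K : AddSubgroup (ℤ × G)) (L : ℤ) : Finset ℤ :=
  {i ∈ Ico 0 L | ∃ x, (i, x) ∈ K}

lemma mem_verticalPart {K : AddSubgroup (ℤ × G)} {x : G} : x ∈ verticalPart K ↔ (0, x) ∈ K :=
  Iff.rfl

lemma mem_levels {K : AddSubgroup (ℤ × G)} {L i : ℤ} :
    i ∈ levels K L ↔ (0 ≤ i ∧ i < L) ∧ ∃ x, (i, x) ∈ K := by
  simp only [levels, mem_filter, mem_Ico]

lemma card_image_fst_le_card_levels {L : ℤ} {X : Finset (ℤ × G)} (hX : ∀ z ∈ X, 0 ≤ z.1 ∧ z.1 < L)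
    (hρ : ∀ z ∈ X, ∀ w ∈ X, ρ z = ρ w) : #(X.image Prod.fst) ≤ #(levels ρ.ker L) := by
  rcases X.eq_empty_or_nonempty with rfl | hne
  · exact Nat.zero_le _
  obtain ⟨w, hw, hmin⟩ := exists_min_image X Prod.fst hne
  refine card_le_card_of_injOn (· - w.1) (fun i hi => ?_) sub_left_injective.injOn
  obtain ⟨z, hz, rfl⟩ := mem_image.1 hi
  have hle := hmin z hz
  have hzL := hX z hz
  have hwL := hX w hw
  refine mem_levels.2 ⟨⟨by lia, by lia⟩, z.2 - w.2, ?_⟩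
  change ρ (z - w) = 0
  rw [map_sub, hρ z hz w hw, sub_self]

lemma card_levels_pos (K : AddSubgroup (ℤ × G)) {L : ℤ} (hL : 0 < L) : 0 < #(levels K L) :=
  card_pos.2 ⟨0, mem_levels.2 ⟨⟨le_rfl, hL⟩, 0, K.zero_mem⟩⟩

lemma card_le_card_verticalPart {K : AddSubgroup (ℤ × G)} [Finite (verticalPart K)]
    {X : Finset (ℤ × G)} (hX : ∀ z ∈ X, ∀ w ∈ X, z.1 = w.1 ∧ z - w ∈ K) :
    #X ≤ Nat.card (verticalPart K) := by
  classical
  rcases X.eq_empty_or_nonempty with rfl | ⟨w, hw⟩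
  · exact Nat.zero_le _
  have hinj : Set.InjOn Prod.snd (X : Set (ℤ × G)) := fun u hu v hv huv =>
    Prod.ext (hX u hu v hv).1 huv
  rw [← card_image_of_injOn hinj]
  refine card_le_natCard_of_sub_mem w.2 fun y hy => ?_
  obtain ⟨z, hz, rfl⟩ := mem_image.1 hy
  obtain ⟨hfst, hsub⟩ := hX z hz w hw
  rw [mem_verticalPart, ← sub_eq_zero.2 hfst]
  exact hsub

variable [DecidableEq Γ]

lemma sum_card_class_le (B : Finset (ℤ × G)) (T : Finset Γ) :
    ∑ γ ∈ T, #{z ∈ B | ρ z = γ} ≤ #B :=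
  (sum_card_fiberwise_eq_card_filter B T ρ).trans_le (card_filter_le _ _)

lemma card_image_fst_le_card_image_mul {L : ℤ} {X : Finset (ℤ × G)}
    (hX : ∀ z ∈ X, 0 ≤ z.1 ∧ z.1 < L) :
    #(X.image Prod.fst) ≤ #(X.image ρ) * #(levels ρ.ker L) := by
  have hsub : X.image Prod.fst ⊆
      (X.image ρ).biUnion fun c => {z ∈ X | ρ z = c}.image Prod.fst := by
    intro i hi
    obtain ⟨z, hz, rfl⟩ := mem_image.1 hi
    exact mem_biUnion.2 ⟨ρ z, mem_image_of_mem _ hz,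
      mem_image_of_mem _ (mem_filter.2 ⟨hz, rfl⟩)⟩
  refine (card_le_card hsub).trans (card_biUnion_le_card_mul _ _ _ fun c _ => ?_)
  exact card_image_fst_le_card_levels (fun z hz => hX z (mem_filter.1 hz).1)
    fun z hz w hw => (mem_filter.1 hz).2.trans (mem_filter.1 hw).2.symm

variable [Finite (verticalPart ρ.ker)]

lemma card_le_card_image_mul_card_verticalPart {X : Finset (ℤ × G)} (i : ℤ)
    (hX : ∀ z ∈ X, z.1 = i) : #X ≤ #(X.image ρ) * Nat.card (verticalPart ρ.ker) := by
  rw [mul_comm]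
  refine card_le_mul_card_image X _ fun c _ => card_le_card_verticalPart fun z hz w hw => ?_
  obtain ⟨hzX, hzc⟩ := mem_filter.1 hz
  obtain ⟨hwX, hwc⟩ := mem_filter.1 hw
  exact ⟨(hX z hzX).trans (hX w hwX).symm, by
    rw [AddMonoidHom.mem_ker, map_sub, hzc, hwc, sub_self]⟩

lemma card_le_card_image_mul_card_levels_mul {L : ℤ} {X : Finset (ℤ × G)}
    (hX : ∀ z ∈ X, 0 ≤ z.1 ∧ z.1 < L) :
    #X ≤ #(X.image ρ) * (#(levels ρ.ker L) * Nat.card (verticalPart ρ.ker)) := by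
  rw [mul_comm]
  refine card_le_mul_card_image X _ fun c _ => ?_
  have hfst : #({z ∈ X | ρ z = c}.image Prod.fst) ≤ #(levels ρ.ker L) :=
    card_image_fst_le_card_levels (fun z hz => hX z (mem_filter.1 hz).1)
      fun z hz w hw => (mem_filter.1 hz).2.trans (mem_filter.1 hw).2.symm
  refine (card_le_mul_card_image (f := Prod.fst) _ (Nat.card (verticalPart ρ.ker))
    fun i _ => card_le_card_verticalPart fun z hz w hw => ?_).trans
    (mul_comm (#(levels ρ.ker L)) _ ▸ Nat.mul_le_mul_left _ hfst)
  simp only [mem_filter] at hz hw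
  exact ⟨hz.2.trans hw.2.symm, by rw [AddMonoidHom.mem_ker, map_sub, hz.1.2, hw.1.2, sub_self]⟩

end Fibers

section Classes

variable {G Γ : Type*} [AddCommGroup G] [AddCommGroup Γ] [DecidableEq G]
  {ρ : ℤ × G →+ Γ} [Finite (verticalPart ρ.ker)]

/- The stabilizer in Kneser's theorem is finite, hence lies over `0` because `ℤ` has no torsion. -/
lemma card_add_card_le_card_add_add_card_verticalPart {X Y : Finset (ℤ × G)} {c e : Γ}
    (hX : X.Nonempty) (hY : Y.Nonempty) (hXc : ∀ z ∈ X, ρ z = c) (hYe : ∀ z ∈ Y, ρ z = e) :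
    #X + #Y ≤ #(X + Y) + Nat.card (verticalPart ρ.ker) := by
  have hfin := finite_stabilizer_of_nonempty (hX.add hY)
  refine (card_add_card_le_card_add_add_card_stabilizer hX hY).trans (Nat.add_le_add_left ?_ _)
  obtain ⟨F, hF, hFcard⟩ := exists_finset_mem_iff_sub_mem (stabilizer (ℤ × G) (X + Y)) 0
  have hρ : ∀ z ∈ X + Y, ρ z = c + e := by
    intro z hz
    obtain ⟨x, hx, y, hy, rfl⟩ := mem_add.1 hz
    rw [map_add, hXc x hx, hYe y hy]
  have hmem : ∀ z ∈ F, z.1 = 0 ∧ z ∈ ρ.ker := by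
    intro z hz
    have hzS := (hF z).1 hz
    rw [sub_zero] at hzS
    constructor
    · have hz_fin : IsOfFinAddOrder z.1 := ((AddSubgroup.subtype _).isOfFinAddOrder
        (isOfFinAddOrder_of_finite (⟨z, hzS⟩ : stabilizer (ℤ × G) (X + Y)))).fst
      exact (isOfFinAddOrder_iff_eq_zero _).1 hz_fin
    · obtain ⟨w, hw⟩ := hX.add hY
      have h := hρ _ ((mem_stabilizer_finset.1 hzS w).2 hw)
      rwa [vadd_eq_add, map_add, hρ w hw, add_eq_right] at h
  rw [← hFcard]
  exact card_le_card_verticalPart fun z hz w hw =>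
    ⟨(hmem z hz).1.trans (hmem w hw).1.symm, sub_mem (hmem z hz).2 (hmem w hw).2⟩

variable [DecidableEq Γ] {B : Finset (ℤ × G)}

lemma card_class_add_card_class_le {δ ε : Γ} (hδ : δ ∈ B.image ρ) (hε : ε ∈ B.image ρ) :
    #{z ∈ B | ρ z = δ} + #{z ∈ B | ρ z = ε} ≤
      #{z ∈ B + B | ρ z = δ + ε} + Nat.card (verticalPart ρ.ker) := by
  obtain ⟨x, hx, hxδ⟩ := mem_image.1 hδ
  obtain ⟨y, hy, hyε⟩ := mem_image.1 hε
  refine (card_add_card_le_card_add_add_card_verticalPart (ρ := ρ) (c := δ) (e := ε)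
    ⟨x, mem_filter.2 ⟨hx, hxδ⟩⟩ ⟨y, mem_filter.2 ⟨hy, hyε⟩⟩ (fun z hz => (mem_filter.1 hz).2)
    fun z hz => (mem_filter.1 hz).2).trans (Nat.add_le_add_right (card_le_card fun z hz => ?_) _)
  obtain ⟨u, hu, v, hv, rfl⟩ := mem_add.1 hz
  rw [mem_filter] at hu hv ⊢
  exact ⟨add_mem_add hu.1 hv.1, by rw [map_add, hu.2, hv.2]⟩

lemma three_mul_card_le_of_two_classes (hk : #(B.image ρ) = 2)
    (hDD : 3 ≤ #(B.image ρ + B.image ρ)) :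
    3 * #B ≤ #(B + B) + 3 * Nat.card (verticalPart ρ.ker) := by
  have hB := card_eq_sum_card_image ρ B
  have hpair := fun δ ε => card_class_add_card_class_le (ρ := ρ) (B := B) (δ := δ) (ε := ε)
  obtain ⟨x, y, hxy, hD⟩ := card_eq_two.1 hk
  rw [hD] at hDD hB hpair
  rw [sum_pair hxy] at hB
  have hdiag : x + x ≠ y + y := by
    intro h
    have hsub : ({x, y} : Finset Γ) + {x, y} ⊆ {x + x, x + y} := by
      intro z hz
      simp only [mem_add, mem_insert, mem_singleton] at hz ⊢
      grind
    exact absurd (hDD.trans ((card_le_card hsub).trans card_le_two)) (by norm_num)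
  have hsum := sum_card_class_le (ρ := ρ) (B + B) {x + x, x + y, y + y}
  rw [sum_insert (by simp [hxy, hdiag]), sum_pair (by simpa using hxy)] at hsum
  have hxx := hpair x x (by simp) (by simp)
  have hxy := hpair x y (by simp) (by simp)
  have hyy := hpair y y (by simp) (by simp)
  omega

/- The three sums with `x` are distinct; of the other two sums in `D + D`, at worst, one is `y + z`
and the other is `z + z`. -/
lemma card_le_of_three_classes {x y z : Γ} (hxy : x ≠ y) (hxz : x ≠ z) (hyz : y ≠ z)
    (hD : B.image ρ = {x, y, z}) (hDD : 5 ≤ #(B.image ρ + B.image ρ))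
    (hzy : #{w ∈ B | ρ w = z} ≤ #{w ∈ B | ρ w = y}) :
    4 * #{w ∈ B | ρ w = x} + 2 * #{w ∈ B | ρ w = y} + 4 * #{w ∈ B | ρ w = z} ≤
      #(B + B) + 5 * Nat.card (verticalPart ρ.ker) := by
  have hpair := fun δ ε => card_class_add_card_class_le (ρ := ρ) (B := B) (δ := δ) (ε := ε)
  rw [hD] at hDD hpair
  obtain ⟨γ, hγ, γ', hγ', hne⟩ : ∃ γ ∈ (({x, y, z} : Finset Γ) + {x, y, z}) \
      {x + x, x + y, x + z}, ∃ γ' ∈ (({x, y, z} : Finset Γ) + {x, y, z}) \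
      {x + x, x + y, x + z}, γ ≠ γ' := by
    refine one_lt_card.1 ?_
    have hthree : #({x + x, x + y, x + z} : Finset Γ) ≤ 3 := card_le_three
    have hdiff := le_card_sdiff ({x + x, x + y, x + z} : Finset Γ) ({x, y, z} + {x, y, z})
    omega
  have hsums : ∀ w ∈ (({x, y, z} : Finset Γ) + {x, y, z}) \ {x + x, x + y, x + z},
      w = y + y ∨ w = y + z ∨ w = z + z := by
    intro w hw
    simp only [mem_sdiff, mem_add, mem_insert, mem_singleton, not_or] at hw
    grind
  have hsum := sum_card_class_le (ρ := ρ) (B + B) {γ, γ', x + x, x + y, x + z}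
  rw [sum_insert (by simpa [hne] using (mem_sdiff.1 hγ).2), sum_insert (mem_sdiff.1 hγ').2,
    sum_insert (by simp [hxy, hxz]), sum_pair (by simpa using hyz)] at hsum
  have hxx := hpair x x (by simp) (by simp)
  have hxy := hpair x y (by simp) (by simp)
  have hxz := hpair x z (by simp) (by simp)
  have hyy := hpair y y (by simp) (by simp)
  have hyz := hpair y z (by simp) (by simp)
  have hzz := hpair z z (by simp) (by simp)
  rcases hsums γ hγ with rfl | rfl | rfl <;> rcases hsums γ' hγ' with rfl | rfl | rfl <;>
    first
      | exact absurd rfl hne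
      | omega

lemma mul_card_le_of_card_le_card_class_add {c r : ℕ} (hDD : r ≤ #(B.image ρ + B.image ρ))
    (hclass : ∀ δ ∈ B.image ρ, #B ≤ #{z ∈ B | ρ z = δ} + c) :
    r * (2 * #B) ≤ #(B + B) + r * (2 * c + Nat.card (verticalPart ρ.ker)) := by
  obtain ⟨T, hT, rfl⟩ := exists_subset_card_eq hDD
  calc #T * (2 * #B)
    _ ≤ ∑ γ ∈ T, (#{z ∈ B + B | ρ z = γ} + (2 * c + Nat.card (verticalPart ρ.ker))) := by
      refine card_nsmul_le_sum T _ _ fun γ hγ => ?_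
      obtain ⟨δ, hδ, ε, hε, rfl⟩ := mem_add.1 (hT hγ)
      have := card_class_add_card_class_le hδ hε
      have := hclass δ hδ
      have := hclass ε hε
      omega
    _ ≤ #(B + B) + #T * (2 * c + Nat.card (verticalPart ρ.ker)) := by
      rw [sum_add_distrib, sum_const, smul_eq_mul]
      exact Nat.add_le_add_right (sum_card_class_le _ T) _

end Classes

section Normalized

variable {G Γ : Type*} [AddCommGroup G] [DecidableEq G]

/-- A finite subset of `ℤ × G` placed so that its lowest fibre lies over `0` and contains `0`,
with `g` a point of its highest fibre. -/
structure IsNormalized (B : Finset (ℤ × G)) (g : ℤ × G) : Prop where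
  zero_mem : 0 ∈ B
  top_mem : g ∈ B
  fst_nonneg : ∀ z ∈ B, 0 ≤ z.1
  fst_le : ∀ z ∈ B, z.1 ≤ g.1
  fst_pos : 0 < g.1

/-- The points over `0` that `B` and its translate `B - g` have in common: those that are counted
twice when `B` is reduced modulo a top point `g`. -/
def overlap (B : Finset (ℤ × G)) (g : ℤ × G) : Finset (ℤ × G) :=
  {z ∈ B | z.1 = 0 ∧ z + g ∈ B}

/-- The lower bound `∑ᵢ max(|Bᵢ|, |M|)` for the loss of `B + B` modulo `g`, where the `Bᵢ` are the
nonempty fibres of `B` and `M` is the overlap. -/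
def fiberMaxSum (B : Finset (ℤ × G)) (g : ℤ × G) : ℕ :=
  ∑ i ∈ B.image Prod.fst, max #{z ∈ B | z.1 = i} #(overlap B g)

variable {B : Finset (ℤ × G)} {g : ℤ × G}

/- Every `z ∈ B + B` with `z + g ∈ B + B` is lost modulo `g`; over `i` these contain `Bᵢ`, and also
`M + w` for any `w ∈ Bᵢ`. -/
lemma card_image_add_fiberMaxSum_le [AddCommGroup Γ] [DecidableEq Γ] {φ : ℤ × G →+ Γ}
    (hB : IsNormalized B g) (hφ : φ g = 0) :
    #((B + B).image φ) + fiberMaxSum B g ≤ #(B + B) := by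
  rw [← card_filter_add_card_filter_not (s := B + B) (fun z => z + g ∈ B + B), add_comm]
  refine add_le_add ?_ ?_
  · refine le_trans (sum_le_sum fun i hi => ?_)
      ((sum_card_fiberwise_eq_card_filter {z ∈ B + B | z + g ∈ B + B}
        (B.image Prod.fst) Prod.fst).trans_le (card_filter_le _ _))
    obtain ⟨w, hw, rfl⟩ := mem_image.1 hi
    refine max_le (card_le_card fun z hz => ?_) ?_
    · obtain ⟨hz, hzw⟩ := mem_filter.1 hz
      refine mem_filter.2 ⟨mem_filter.2 ⟨?_, add_mem_add hz hB.top_mem⟩, hzw⟩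
      simpa only [add_zero] using add_mem_add hz hB.zero_mem
    · refine card_le_card_of_injOn (· + w) (fun z hz => ?_) (add_left_injective w).injOn
      obtain ⟨hz, hz0, hzg⟩ := mem_filter.1 hz
      refine mem_coe.2 (mem_filter.2 ⟨mem_filter.2 ⟨add_mem_add hz hw, ?_⟩, by simp [hz0]⟩)
      rw [add_right_comm]
      exact add_mem_add hzg hw
  · refine (card_le_card fun q hq => ?_).trans (card_image_le (f := φ))
    obtain ⟨z, hz, rfl⟩ := mem_image.1 hq
    obtain ⟨t, ht, hmax⟩ := exists_max_image {w ∈ B + B | φ w = φ z} Prod.fst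
      ⟨z, mem_filter.2 ⟨hz, rfl⟩⟩
    obtain ⟨ht, htz⟩ := mem_filter.1 ht
    refine mem_image.2 ⟨t, mem_filter.2 ⟨ht, fun htg => ?_⟩, htz⟩
    have hle := hmax _ (mem_filter.2 ⟨htg, by rw [map_add, hφ, add_zero, htz]⟩)
    have hpos := hB.fst_pos
    rw [Prod.fst_add] at hle
    omega

lemma card_add_card_mul_card_overlap_le {T : Finset ℤ} (hT : T ⊆ B.image Prod.fst) :
    #B + #T * #(overlap B g) ≤ fiberMaxSum B g + ∑ i ∈ T, #{z ∈ B | z.1 = i} := by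
  rw [card_eq_sum_card_image Prod.fst B, fiberMaxSum, ← sum_sdiff hT,
    ← sum_sdiff (f := fun i => max _ _) hT, ← smul_eq_mul, ← sum_const]
  have hrest : ∑ i ∈ B.image Prod.fst \ T, #{z ∈ B | z.1 = i} ≤
      ∑ i ∈ B.image Prod.fst \ T, max #{z ∈ B | z.1 = i} #(overlap B g) :=
    sum_le_sum fun i _ => le_max_left _ _
  have hT_le : ∑ _i ∈ T, #(overlap B g) ≤ ∑ i ∈ T, max #{z ∈ B | z.1 = i} #(overlap B g) :=
    sum_le_sum fun i _ => le_max_right _ _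
  omega

lemma card_le_fiberMaxSum : #B ≤ fiberMaxSum B g := by
  simpa using card_add_card_mul_card_overlap_le (B := B) (g := g) (empty_subset _)

lemma card_image_fst_mul_card_overlap_le :
    #(B.image Prod.fst) * #(overlap B g) ≤ fiberMaxSum B g := by
  have h := card_add_card_mul_card_overlap_le (B := B) (g := g) subset_rfl
  rwa [← card_eq_sum_card_image, add_comm, Nat.add_le_add_iff_right] at h

variable [AddCommGroup Γ] [DecidableEq Γ] {ρ : ℤ × G →+ Γ} [Finite (verticalPart ρ.ker)]

lemma card_le_card_image_mul_add_card_overlap (hB : IsNormalized B g) (hρ : ρ g = 0) :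
    #B ≤ #(B.image ρ) * (#(levels ρ.ker g.1) * Nat.card (verticalPart ρ.ker)) +
      #(overlap B g) := by
  set V := {z ∈ B | ¬ z.1 < g.1}.image (· - g)
  have hV : ∀ w ∈ V, w.1 = 0 ∧ w + g ∈ B := by
    intro w hw
    obtain ⟨z, hz, rfl⟩ := mem_image.1 hw
    obtain ⟨hz, hzg⟩ := mem_filter.1 hz
    have hle := hB.fst_le z hz
    exact ⟨by rw [Prod.fst_sub]; omega, by simpa using hz⟩
  have hsplit : #{z ∈ B | z.1 < g.1} + #V = #B := by
    rw [card_image_of_injective _ sub_left_injective]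
    exact card_filter_add_card_filter_not _
  have hinter : #({z ∈ B | z.1 < g.1} ∩ V) ≤ #(overlap B g) := by
    refine card_le_card fun z hz => ?_
    rw [mem_inter] at hz
    exact mem_filter.2 ⟨(mem_filter.1 hz.1).1, hV z hz.2⟩
  have hunion : #({z ∈ B | z.1 < g.1} ∪ V) ≤
      #(B.image ρ) * (#(levels ρ.ker g.1) * Nat.card (verticalPart ρ.ker)) := by
    refine (card_le_card_image_mul_card_levels_mul (ρ := ρ) (L := g.1) fun z hz => ?_).trans
      (Nat.mul_le_mul_right _ (card_le_card fun c hc => ?_))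
    · rcases mem_union.1 hz with h | h
      · exact ⟨hB.fst_nonneg z (mem_filter.1 h).1, (mem_filter.1 h).2⟩
      · exact (hV z h).1.symm ▸ ⟨le_rfl, hB.fst_pos⟩
    · obtain ⟨z, hz, rfl⟩ := mem_image.1 hc
      rcases mem_union.1 hz with h | h
      · exact mem_image_of_mem _ (mem_filter.1 h).1
      · exact mem_image.2 ⟨_, (hV z h).2, by rw [map_add, hρ, add_zero]⟩
  have hcard := card_union_add_card_inter {z ∈ B | z.1 < g.1} V
  omega

end Normalized

section ZeroClasses

variable {G Γ : Type*} [AddCommGroup G] [AddCommGroup Γ]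
  {ρ : ℤ × G →+ Γ} {B : Finset (ℤ × G)} {g : ℤ × G} {δ : Γ}

open scoped Classical in
/-- The points of `B` over the integers over which the kernel of `ρ` has no element. -/
noncomputable def offPart (ρ : ℤ × G →+ Γ) (B : Finset (ℤ × G)) : Finset (ℤ × G) :=
  {z ∈ B | ¬ ∃ x, (z.1, x) ∈ ρ.ker}

lemma mem_offPart {z : ℤ × G} : z ∈ offPart ρ B ↔ z ∈ B ∧ ¬ ∃ x, (z.1, x) ∈ ρ.ker := by
  simp only [offPart, mem_filter]

lemma card_image_fst_le_card_image_fst_offPart_add (hB : IsNormalized B g) :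
    #(B.image Prod.fst) ≤ #((offPart ρ B).image Prod.fst) + (#(levels ρ.ker g.1) + 1) := by
  have hsub : B.image Prod.fst ⊆
      (offPart ρ B).image Prod.fst ∪ insert g.1 (levels ρ.ker g.1) := by
    intro i hi
    obtain ⟨z, hz, rfl⟩ := mem_image.1 hi
    rw [mem_union, mem_insert, mem_levels]
    by_cases hker : ∃ x, (z.1, x) ∈ ρ.ker
    · rcases (hB.fst_le z hz).eq_or_lt with h | h
      · exact .inr (.inl h)
      · exact .inr (.inr ⟨⟨hB.fst_nonneg z hz, h⟩, hker⟩)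
    · exact .inl (mem_image_of_mem _ (mem_offPart.2 ⟨hz, hker⟩))
  exact (card_le_card hsub).trans ((card_union_le _ _).trans
    (Nat.add_le_add_left (card_insert_le _ _) _))

lemma fst_mem_Ico_of_mem_offPart (hB : IsNormalized B g) (hρ : ρ g = 0) {z : ℤ × G}
    (hz : z ∈ offPart ρ B) : 0 ≤ z.1 ∧ z.1 < g.1 := by
  obtain ⟨hzB, hzker⟩ := mem_offPart.1 hz
  exact ⟨hB.fst_nonneg z hzB, (hB.fst_le z hzB).lt_of_ne fun h => hzker ⟨g.2, by rw [h]; exact hρ⟩⟩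

variable [DecidableEq Γ]

open scoped Classical in
/-- The classes of `ρ` that meet both `B` and `{0} × G`. -/
noncomputable def zeroClasses (ρ : ℤ × G →+ Γ) (B : Finset (ℤ × G)) : Finset Γ :=
  {δ ∈ B.image ρ | ∃ x, ρ (0, x) = δ}

/-- The classes of `ρ` that meet `B` but not `{0} × G`. -/
noncomputable def offClasses (ρ : ℤ × G →+ Γ) (B : Finset (ℤ × G)) : Finset Γ :=
  B.image ρ \ zeroClasses ρ B

lemma mem_zeroClasses : δ ∈ zeroClasses ρ B ↔ δ ∈ B.image ρ ∧ ∃ x, ρ (0, x) = δ := by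
  simp only [zeroClasses, mem_filter]

lemma card_zeroClasses_add_card_offClasses :
    #(zeroClasses ρ B) + #(offClasses ρ B) = #(B.image ρ) := by
  rw [add_comm]
  exact card_sdiff_add_card_eq_card fun δ hδ => (mem_zeroClasses.1 hδ).1

lemma card_zeroClasses_pos (h0 : 0 ∈ B) : 0 < #(zeroClasses ρ B) :=
  card_pos.2 ⟨0, mem_zeroClasses.2 ⟨mem_image.2 ⟨0, h0, map_zero ρ⟩, 0, map_zero ρ⟩⟩

lemma image_offPart_subset_offClasses : (offPart ρ B).image ρ ⊆ offClasses ρ B := by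
  intro δ hδ
  obtain ⟨z, hz, rfl⟩ := mem_image.1 hδ
  obtain ⟨hzB, hzker⟩ := mem_offPart.1 hz
  refine mem_sdiff.2 ⟨mem_image_of_mem _ hzB, fun h => hzker ?_⟩
  obtain ⟨x, hx⟩ := (mem_zeroClasses.1 h).2
  refine ⟨z.2 - x, ?_⟩
  have hz_sub : ((z.1, z.2 - x) : ℤ × G) = z - (0, x) := by ext <;> simp
  rw [AddMonoidHom.mem_ker, hz_sub, map_sub, hx, sub_self]

lemma card_image_fst_offPart_le (hB : IsNormalized B g) (hρ : ρ g = 0) :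
    #((offPart ρ B).image Prod.fst) ≤ #(offClasses ρ B) * #(levels ρ.ker g.1) :=
  (card_image_fst_le_card_image_mul fun _ hz => fst_mem_Ico_of_mem_offPart hB hρ hz).trans
    (Nat.mul_le_mul_right _ (card_le_card image_offPart_subset_offClasses))

variable [Finite (verticalPart ρ.ker)]

lemma card_offPart_le (hB : IsNormalized B g) (hρ : ρ g = 0) :
    #(offPart ρ B) ≤
      #(offClasses ρ B) * (#(levels ρ.ker g.1) * Nat.card (verticalPart ρ.ker)) :=
  (card_le_card_image_mul_card_levels_mul fun _ hz => fst_mem_Ico_of_mem_offPart hB hρ hz).trans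
    (Nat.mul_le_mul_right _ (card_le_card image_offPart_subset_offClasses))

lemma card_fiber_le_of_mem_image_fst_offPart {i : ℤ} (hi : i ∈ (offPart ρ B).image Prod.fst) :
    #{z ∈ B | z.1 = i} ≤ #(offClasses ρ B) * Nat.card (verticalPart ρ.ker) := by
  refine (card_le_card_image_mul_card_verticalPart (ρ := ρ) i
    fun z hz => (mem_filter.1 hz).2).trans (Nat.mul_le_mul_right _ (card_le_card ?_))
  refine (image_subset_image fun z hz => ?_).trans image_offPart_subset_offClasses
  obtain ⟨w, hw, rfl⟩ := mem_image.1 hi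
  obtain ⟨hzB, hzw⟩ := mem_filter.1 hz
  exact mem_offPart.2 ⟨hzB, hzw ▸ (mem_offPart.1 hw).2⟩

lemma card_class_le_of_notMem_zeroClasses (hB : IsNormalized B g) (hρ : ρ g = 0)
    (hδ : δ ∉ zeroClasses ρ B) :
    #{z ∈ B | ρ z = δ} ≤ #(levels ρ.ker g.1) * Nat.card (verticalPart ρ.ker) := by
  refine (card_le_card_image_mul_card_levels_mul (ρ := ρ) (L := g.1) fun z hz => ?_).trans
    ((Nat.mul_le_mul_right _ (card_le_one.2 ?_)).trans_eq (one_mul _))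
  · obtain ⟨hzB, hzδ⟩ := mem_filter.1 hz
    refine ⟨hB.fst_nonneg z hzB, (hB.fst_le z hzB).lt_of_ne fun h => hδ ?_⟩
    refine mem_zeroClasses.2 ⟨hzδ ▸ mem_image_of_mem _ hzB, z.2 - g.2, ?_⟩
    have hz_sub : ((0, z.2 - g.2) : ℤ × G) = z - g := by ext <;> simp [h]
    rw [hz_sub, map_sub, hρ, sub_zero, hzδ]
  · simp only [mem_image, mem_filter]
    rintro _ ⟨z, ⟨-, rfl⟩, rfl⟩ _ ⟨w, ⟨-, hw⟩, rfl⟩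
    exact hw.symm

lemma card_class_le (hB : IsNormalized B g) (δ : Γ) :
    #{z ∈ B | ρ z = δ} ≤ #(levels ρ.ker g.1) * Nat.card (verticalPart ρ.ker) +
      Nat.card (verticalPart ρ.ker) := by
  have hone : ∀ X ⊆ {z ∈ B | ρ z = δ}, #(X.image ρ) ≤ 1 := by
    refine fun X hX => card_le_one.2 ?_
    simp only [mem_image]
    rintro _ ⟨z, hz, rfl⟩ _ ⟨w, hw, rfl⟩
    exact (mem_filter.1 (hX hz)).2.trans (mem_filter.1 (hX hw)).2.symm
  rw [← card_filter_add_card_filter_not (s := {z ∈ B | ρ z = δ}) (fun z => z.1 < g.1)]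
  refine add_le_add ?_ ?_
  · refine (card_le_card_image_mul_card_levels_mul (ρ := ρ) (L := g.1) fun z hz => ?_).trans
      ((Nat.mul_le_mul_right _ (hone _ (filter_subset _ _))).trans_eq (one_mul _))
    obtain ⟨hz, hzg⟩ := mem_filter.1 hz
    exact ⟨hB.fst_nonneg z (mem_filter.1 hz).1, hzg⟩
  · refine (card_le_card_image_mul_card_verticalPart (ρ := ρ) g.1 fun z hz => ?_).trans
      ((Nat.mul_le_mul_right _ (hone _ (filter_subset _ _))).trans_eq (one_mul _))
    obtain ⟨hz, hzg⟩ := mem_filter.1 hz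
    exact (hB.fst_le z (mem_filter.1 hz).1).antisymm (not_lt.1 hzg)

lemma card_overlap_le [DecidableEq G] :
    #(overlap B g) ≤ #(zeroClasses ρ B) * Nat.card (verticalPart ρ.ker) := by
  refine (card_le_card_image_mul_card_verticalPart (ρ := ρ) 0
    fun z hz => (mem_filter.1 hz).2.1).trans (Nat.mul_le_mul_right _ (card_le_card fun c hc => ?_))
  obtain ⟨z, hz, rfl⟩ := mem_image.1 hc
  obtain ⟨hzB, hz0, -⟩ := mem_filter.1 hz
  exact mem_zeroClasses.2 ⟨mem_image_of_mem _ hzB, z.2, by rw [← hz0]⟩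

end ZeroClasses

section Rigidity

lemma exists_eq_triple_antitone {α : Type*} [DecidableEq α] {s : Finset α} (hs : #s = 3)
    (f : α → ℕ) : ∃ x y z, x ≠ y ∧ x ≠ z ∧ y ≠ z ∧ s = {x, y, z} ∧ f y ≤ f x ∧ f z ≤ f y := by
  obtain ⟨x, hx, hmax⟩ := exists_max_image s f (card_pos.1 (by omega))
  obtain ⟨y, z, hyz, hyz_eq⟩ := card_eq_two.1
    (show #(s.erase x) = 2 by rw [card_erase_of_mem hx, hs])
  wlog hle : f z ≤ f y generalizing y z
  · exact this z y hyz.symm (by rw [hyz_eq, pair_comm]) (le_of_not_ge hle)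
  obtain ⟨hyx, hy⟩ := mem_erase.1 (show y ∈ s.erase x by simp [hyz_eq])
  obtain ⟨hzx, -⟩ := mem_erase.1 (show z ∈ s.erase x by simp [hyz_eq])
  exact ⟨x, y, z, hyx.symm, hzx.symm, hyz, by rw [← hyz_eq, insert_erase hx], hmax y hy, hle⟩

variable {G Γ : Type*} [AddCommGroup G] [AddCommGroup Γ] [DecidableEq G] [DecidableEq Γ]

/-- A set with doubling below `5 / 2` and at least six fibres, normalized with top point `g`, and a
homomorphism `ρ` killing `g`, subject to what Kneser's theorem modulo `g` provides: the image `D` of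
`B` satisfies `|D + D| ≥ 2|D| - 1`, and modulo `g` each of the `|D + D|` classes is contained in
`B + B` and has at least `ℓh` elements, where `ℓ` counts the levels of the kernel of `ρ` below `g`
and `h` is the order of its vertical part. -/
structure IsKneserReduction (ρ : ℤ × G →+ Γ) (B : Finset (ℤ × G)) (g : ℤ × G) : Prop
    extends IsNormalized B g where
  map_top : ρ g = 0
  six_le : 6 ≤ #(B.image Prod.fst)
  doubling : 2 * #(B + B) < 5 * #B
  card_le : 2 * #(B.image ρ) ≤ #(B.image ρ + B.image ρ) + 1
  sum_le : #(B.image ρ + B.image ρ) *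
    (#(levels ρ.ker g.1) * Nat.card (verticalPart ρ.ker)) + fiberMaxSum B g ≤ #(B + B)

namespace IsKneserReduction

variable {ρ : ℤ × G →+ Γ} {B : Finset (ℤ × G)} {g : ℤ × G}

lemma six_le_card_levels_add (R : IsKneserReduction ρ B g) :
    6 ≤ #(levels ρ.ker g.1) + 1 + #(offClasses ρ B) * #(levels ρ.ker g.1) := by
  have hfst := card_image_fst_le_card_image_fst_offPart_add (ρ := ρ) R.toIsNormalized
  have hoff := card_image_fst_offPart_le R.toIsNormalized R.map_top
  have hsix := R.six_le
  omega

lemma two_mul_card_image_mul_add_fiberMaxSum_le (R : IsKneserReduction ρ B g) :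
    2 * (#(B.image ρ) * (#(levels ρ.ker g.1) * Nat.card (verticalPart ρ.ker))) +
      fiberMaxSum B g ≤ #(B + B) + #(levels ρ.ker g.1) * Nat.card (verticalPart ρ.ker) := by
  have hcard := Nat.mul_le_mul_right (#(levels ρ.ker g.1) * Nat.card (verticalPart ρ.ker)) R.card_le
  rw [add_mul, one_mul, mul_assoc] at hcard
  have hsum := R.sum_le
  omega

lemma six_mul_card_overlap_le (R : IsKneserReduction ρ B g) :
    6 * #(overlap B g) ≤ fiberMaxSum B g :=
  (Nat.mul_le_mul_right _ R.six_le).trans card_image_fst_mul_card_overlap_le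

lemma exists_subset_image_fst_offPart (R : IsKneserReduction ρ B g) {r : ℕ}
    (hr : r + #(levels ρ.ker g.1) + 1 ≤ 6) :
    ∃ T ⊆ (offPart ρ B).image Prod.fst, #T = r ∧
      #B + r * #(overlap B g) ≤ fiberMaxSum B g + ∑ i ∈ T, #{z ∈ B | z.1 = i} := by
  have hfst := card_image_fst_le_card_image_fst_offPart_add (ρ := ρ) R.toIsNormalized
  have hsix := R.six_le
  obtain ⟨T, hT, rfl⟩ := exists_subset_card_eq
    (show r ≤ #((offPart ρ B).image Prod.fst) by omega)
  exact ⟨T, hT, rfl, card_add_card_mul_card_overlap_le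
    (hT.trans (image_subset_image fun z hz => (mem_offPart.1 hz).1))⟩

lemma card_levels_eq_two (R : IsKneserReduction ρ B g) (hk : #(B.image ρ) = 3)
    (hℓ : ¬ 3 ≤ #(levels ρ.ker g.1)) : #(levels ρ.ker g.1) = 2 ∧ #(zeroClasses ρ B) = 1 := by
  have hsix := R.six_le_card_levels_add
  have hsplit := card_zeroClasses_add_card_offClasses (ρ := ρ) (B := B)
  have hpos := card_zeroClasses_pos (ρ := ρ) R.zero_mem
  have hlevels := card_levels_pos ρ.ker R.fst_pos
  obtain hℓ | hℓ : #(levels ρ.ker g.1) = 1 ∨ #(levels ρ.ker g.1) = 2 := by omega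
  all_goals
    rw [hℓ] at hsix
    omega

variable [Finite (verticalPart ρ.ker)]

lemma card_add_mul_card_overlap_le (R : IsKneserReduction ρ B g) {r : ℕ}
    (hr : r + #(levels ρ.ker g.1) + 1 ≤ 6) :
    #B + r * #(overlap B g) ≤ fiberMaxSum B g +
      #(offClasses ρ B) * (#(levels ρ.ker g.1) * Nat.card (verticalPart ρ.ker)) := by
  obtain ⟨T, hT, -, h⟩ := R.exists_subset_image_fst_offPart hr
  refine h.trans (Nat.add_le_add_left
    (le_trans ?_ (card_offPart_le R.toIsNormalized R.map_top)) _)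
  rw [sum_card_fiberwise_eq_card_filter]
  refine card_le_card fun z hz => ?_
  obtain ⟨hzB, hzT⟩ := mem_filter.1 hz
  obtain ⟨w, hw, hwz⟩ := mem_image.1 (hT hzT)
  exact mem_offPart.2 ⟨hzB, hwz ▸ (mem_offPart.1 hw).2⟩

lemma card_add_mul_card_overlap_le_add_mul (R : IsKneserReduction ρ B g) {r : ℕ}
    (hr : r + #(levels ρ.ker g.1) + 1 ≤ 6) :
    #B + r * #(overlap B g) ≤ fiberMaxSum B g +
      r * (#(offClasses ρ B) * Nat.card (verticalPart ρ.ker)) := by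
  obtain ⟨T, hT, rfl, h⟩ := R.exists_subset_image_fst_offPart hr
  exact h.trans (Nat.add_le_add_left (sum_le_card_nsmul _ _ _ fun i hi =>
    card_fiber_le_of_mem_image_fst_offPart (hT hi)) _)

lemma card_image_lt_five (R : IsKneserReduction ρ B g) : #(B.image ρ) < 5 := by
  have hB := card_le_card_image_mul_add_card_overlap R.toIsNormalized R.map_top
  have hBB := R.two_mul_card_image_mul_add_fiberMaxSum_le
  have hm := R.six_mul_card_overlap_le
  have hX := card_le_fiberMaxSum (B := B) (g := g)
  have hdbl := R.doubling
  refine lt_of_mul_lt_mul_right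
    (a := #(levels ρ.ker g.1) * Nat.card (verticalPart ρ.ker)) ?_ (Nat.zero_le _)
  omega

lemma card_image_ne_two (R : IsKneserReduction ρ B g) : #(B.image ρ) ≠ 2 := by
  intro hk
  have hD := R.card_le
  have hclasses := three_mul_card_le_of_two_classes hk (by omega)
  have hBB := R.two_mul_card_image_mul_add_fiberMaxSum_le
  have hX := card_le_fiberMaxSum (B := B) (g := g)
  have hdbl := R.doubling
  have hsix := R.six_le_card_levels_add
  have hsplit := card_zeroClasses_add_card_offClasses (ρ := ρ) (B := B)
  have hpos := card_zeroClasses_pos (ρ := ρ) R.zero_mem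
  have hoff : #(offClasses ρ B) ≤ 1 := by omega
  have hℓ : 3 ≤ #(levels ρ.ker g.1) := by
    have hmul := Nat.mul_le_mul_right #(levels ρ.ker g.1) hoff
    omega
  have hℓh := Nat.mul_le_mul_right (Nat.card (verticalPart ρ.ker)) hℓ
  rw [hk] at hBB
  omega

lemma card_image_ne_three (R : IsKneserReduction ρ B g) : #(B.image ρ) ≠ 3 := by
  intro hk
  obtain ⟨x, y, z, hxy, hxz, hyz, hD, hyx, hzy⟩ := exists_eq_triple_antitone hk
    fun δ => #{w ∈ B | ρ w = δ}
  have hcard := R.card_le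
  have hclasses := card_le_of_three_classes hxy hxz hyz hD (by omega) hzy
  have hn := card_eq_sum_card_image ρ B
  rw [hD, sum_insert (by simp [hxy, hxz]), sum_pair hyz] at hn
  have hB := card_le_card_image_mul_add_card_overlap R.toIsNormalized R.map_top
  have hBB := R.two_mul_card_image_mul_add_fiberMaxSum_le
  rw [hk] at hB hBB
  have hm := R.six_mul_card_overlap_le
  have hX := card_le_fiberMaxSum (B := B) (g := g)
  have hdbl := R.doubling
  by_cases hℓ : 3 ≤ #(levels ρ.ker g.1)
  · have hℓh := Nat.mul_le_mul_right (Nat.card (verticalPart ρ.ker)) hℓ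
    omega
  obtain ⟨hℓ, hzero⟩ := R.card_levels_eq_two hk hℓ
  have hout := fun δ (hδ : δ ∉ zeroClasses ρ B) =>
    card_class_le_of_notMem_zeroClasses R.toIsNormalized R.map_top hδ
  rw [hℓ] at hB hBB hout
  have hm₀ := card_overlap_le (ρ := ρ) (B := B) (g := g)
  rw [hzero] at hm₀
  have hx : x ∈ zeroClasses ρ B := by
    by_contra hx
    have hxout := hout x hx
    omega
  have hy := hout y fun hy => hxy (card_le_one.1 hzero.le x hx y hy)
  omega

/- If all classes meet `{0} × G`, then there are five levels and every class has at most `6h`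
elements, so the other three leave at least `#B - 18h` to each class. -/
lemma card_offClasses_ne_zero (R : IsKneserReduction ρ B g)
    (hk : #(B.image ρ) = 4) : #(offClasses ρ B) ≠ 0 := by
  intro hoff
  have hcard := R.card_le
  have hB := card_le_card_image_mul_add_card_overlap R.toIsNormalized R.map_top
  have hBB := R.two_mul_card_image_mul_add_fiberMaxSum_le
  have hm := R.six_mul_card_overlap_le
  have hX := card_le_fiberMaxSum (B := B) (g := g)
  have hdbl := R.doubling
  have hsix := R.six_le_card_levels_add
  have hsplit := card_zeroClasses_add_card_offClasses (ρ := ρ) (B := B)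
  have hm₀ := card_overlap_le (ρ := ρ) (B := B) (g := g)
  rw [hoff, add_zero] at hsplit
  rw [hoff, zero_mul] at hsix
  rw [hsplit, hk] at hm₀
  rw [hk] at hB hBB
  have hℓ : #(levels ρ.ker g.1) < 6 :=
    lt_of_mul_lt_mul_right (a := Nat.card (verticalPart ρ.ker)) (by omega) (Nat.zero_le _)
  have hclass := fun δ => card_class_le (ρ := ρ) R.toIsNormalized δ
  rw [show #(levels ρ.ker g.1) = 5 by omega] at hBB hclass
  have hseven := mul_card_le_of_card_le_card_class_add (ρ := ρ) (B := B)
    (c := 18 * Nat.card (verticalPart ρ.ker)) (r := 7) (by omega) fun δ hδ => by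
      rw [card_eq_sum_card_image ρ B, ← add_sum_erase _ _ hδ]
      refine Nat.add_le_add_left ((sum_le_card_nsmul _ _ _ fun ε _ => hclass ε).trans ?_) _
      rw [card_erase_of_mem hδ, hk, smul_eq_mul]
      omega
  omega

lemma card_image_ne_four (R : IsKneserReduction ρ B g) : #(B.image ρ) ≠ 4 := by
  intro hk
  have hB := card_le_card_image_mul_add_card_overlap R.toIsNormalized R.map_top
  have hBB := R.two_mul_card_image_mul_add_fiberMaxSum_le
  have hX := card_le_fiberMaxSum (B := B) (g := g)
  have hdbl := R.doubling
  have hsix := R.six_le_card_levels_add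
  have hm₀ := card_overlap_le (ρ := ρ) (B := B) (g := g)
  have hoff := R.card_offClasses_ne_zero hk
  have hr₁ := fun r => R.card_add_mul_card_overlap_le (r := r)
  have hr₂ := fun r => R.card_add_mul_card_overlap_le_add_mul (r := r)
  have hsplit := card_zeroClasses_add_card_offClasses (ρ := ρ) (B := B)
  rw [hk] at hB hBB hsplit
  have hℓ : 2 * #(levels ρ.ker g.1) < 3 * #(zeroClasses ρ B) := by
    refine lt_of_mul_lt_mul_right (a := Nat.card (verticalPart ρ.ker)) ?_ (Nat.zero_le _)
    rw [mul_assoc, mul_assoc]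
    omega
  obtain ⟨hk₀, hk₁⟩ | ⟨hk₀, hk₁⟩ | ⟨hk₀, hk₁⟩ :
      #(zeroClasses ρ B) = 3 ∧ #(offClasses ρ B) = 1 ∨
      #(zeroClasses ρ B) = 2 ∧ #(offClasses ρ B) = 2 ∨
      #(zeroClasses ρ B) = 1 ∧ #(offClasses ρ B) = 3 := by omega
  all_goals
    rw [hk₀] at hm₀ hℓ
    rw [hk₁] at hsix hr₁ hr₂
  · obtain hℓ | hℓ : #(levels ρ.ker g.1) = 3 ∨ #(levels ρ.ker g.1) = 4 := by omega
    · have h := hr₂ 2 (by omega)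
      rw [hℓ] at hB hBB
      omega
    · have h := hr₂ 1 (by omega)
      rw [hℓ] at hB hBB
      omega
  · have h := hr₁ 3 (by omega)
    rw [show #(levels ρ.ker g.1) = 2 by omega] at hB hBB h
    omega
  · omega

lemma card_image_le_one (R : IsKneserReduction ρ B g) : #(B.image ρ) ≤ 1 := by
  have h₂ := R.card_image_ne_two
  have h₃ := R.card_image_ne_three
  have h₄ := R.card_image_ne_four
  have h₅ := R.card_image_lt_five
  omega

end IsKneserReduction

end Rigidity

section Cover

open AddSubgroup QuotientAddGroup

variable {G : Type*} [AddCommGroup G] {g : ℤ × G}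

lemma injOn_mk_zmultiples :
    Set.InjOn (mk' (zmultiples g)) {z : ℤ × G | 0 ≤ z.1 ∧ z.1 < g.1} := by
  intro u hu v hv huv
  obtain ⟨j, hj⟩ := mem_zmultiples_iff.1 (QuotientAddGroup.eq.1 huv)
  have hfst : j * g.1 = -u.1 + v.1 := congrArg Prod.fst hj
  obtain rfl : j = 0 := by
    by_contra hj0
    rcases lt_or_gt_of_ne hj0 with h | h <;> nlinarith [hu.1, hu.2, hv.1, hv.2]
  rw [zero_smul] at hj
  exact neg_add_eq_zero.1 hj.symm

variable {S : AddSubgroup ((ℤ × G) ⧸ zmultiples g)} [Finite S]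

lemma finite_verticalPart_comap_mk (hg : 0 < g.1) :
    Finite (verticalPart (S.comap (mk' (zmultiples g)))) := by
  refine Finite.of_injective (β := S) (fun x => ⟨mk' _ (0, x.1), x.2⟩) fun x y hxy => ?_
  exact Subtype.ext (congrArg Prod.snd (injOn_mk_zmultiples (g := g) ⟨le_rfl, hg⟩ ⟨le_rfl, hg⟩
    (congrArg Subtype.val hxy)))

lemma card_levels_mul_card_verticalPart_comap_mk_le :
    #(levels (S.comap (mk' (zmultiples g))) g.1) *
      Nat.card (verticalPart (S.comap (mk' (zmultiples g)))) ≤ Nat.card S := by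
  set K := S.comap (mk' (zmultiples g))
  choose! x hx using fun i (hi : i ∈ levels K g.1) => (mem_levels.1 hi).2
  rw [← Fintype.card_coe, ← Nat.card_eq_fintype_card, ← Nat.card_prod]
  refine Nat.card_le_card_of_injective (fun p : levels K g.1 × verticalPart K =>
    (⟨mk' _ (p.1.1, x p.1.1 + p.2.1), ?_⟩ : S)) fun p q hpq => ?_
  · have hadd : ((p.1.1, x p.1.1 + p.2.1) : ℤ × G) = (p.1.1, x p.1.1) + (0, p.2.1) := by simp
    rw [hadd]
    exact K.add_mem (hx _ p.1.2) p.2.2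
  · have heq := injOn_mk_zmultiples (mem_levels.1 p.1.2).1 (mem_levels.1 q.1.2).1
      (congrArg Subtype.val hpq)
    obtain ⟨hfst, hsnd⟩ := Prod.ext_iff.1 heq
    dsimp only at hfst hsnd
    rw [hfst] at hsnd
    exact Prod.ext (Subtype.ext hfst) (Subtype.ext (add_left_cancel hsnd))

variable [DecidableEq G] {B : Finset (ℤ × G)}

lemma IsNormalized.exists_isKneserReduction (hB : IsNormalized B g)
    (hsix : 6 ≤ #(B.image Prod.fst)) (hdbl : 2 * #(B + B) < 5 * #B) :
    ∃ S : AddSubgroup ((ℤ × G) ⧸ zmultiples g), Finite S ∧ ∀ [DecidableEq (_ ⧸ S)],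
      IsKneserReduction (Γ := _ ⧸ S) ((mk' S).comp (mk' (zmultiples g))) B g := by
  classical
  have hg : mk' (zmultiples g) g = 0 := (eq_zero_iff _).2 (mem_zmultiples _)
  have hsum := card_image_add_fiberMaxSum_le hB hg
  set C := B.image (mk' (zmultiples g))
  have hC : C.Nonempty := ⟨_, mem_image_of_mem _ hB.zero_mem⟩
  set S := stabilizer ((ℤ × G) ⧸ zmultiples g) (C + C)
  have hfin : Finite S := finite_stabilizer_of_nonempty (hC.add hC)
  refine ⟨S, hfin, fun {_} => ?_⟩
  have himage : C.image (mk' S) = B.image ((mk' S).comp (mk' (zmultiples g))) := image_image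
  have hkneser := card_image_mk_add_card_image_mk_le hC hC
  have hcard := card_eq_card_image_mk_mul_card_stabilizer (hC.add hC)
  rw [image_add, himage] at hcard hkneser
  rw [← two_mul] at hkneser
  rw [image_add, hcard] at hsum
  refine ⟨hB, ?_, hsix, hdbl, hkneser, ?_⟩
  · rw [AddMonoidHom.comp_apply, hg, map_zero]
  · refine (Nat.add_le_add_right (Nat.mul_le_mul_left _ ?_) _).trans hsum
    rw [← AddMonoidHom.comap_ker, ker_mk']
    exact card_levels_mul_card_verticalPart_comap_mk_le

theorem IsNormalized.exists_addSubgroup (hB : IsNormalized B g)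
    (hsix : 6 ≤ #(B.image Prod.fst)) (hdbl : 2 * #(B + B) < 5 * #B) :
    ∃ K : AddSubgroup (ℤ × G), Finite (verticalPart K) ∧ (∀ z ∈ B, z ∈ K) ∧
      #(levels K g.1) * Nat.card (verticalPart K) + #B ≤ #(B + B) := by
  classical
  obtain ⟨S, hS, R⟩ := hB.exists_isKneserReduction hsix hdbl
  have hfin : Finite (verticalPart ((mk' S).comp (mk' (zmultiples g))).ker) := by
    rw [← AddMonoidHom.comap_ker, ker_mk']
    exact finite_verticalPart_comap_mk hB.fst_pos
  generalize (mk' S).comp (mk' (zmultiples g)) = ρ at R hfin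
  have h0 : ρ 0 ∈ B.image ρ := mem_image_of_mem _ hB.zero_mem
  refine ⟨ρ.ker, hfin, fun z hz => ?_, ?_⟩
  · rw [AddMonoidHom.mem_ker, ← map_zero ρ]
    exact card_le_one.1 R.card_image_le_one _ (mem_image_of_mem _ hz) _ h0
  · have hmul := Nat.le_mul_of_pos_left
      (#(levels ρ.ker g.1) * Nat.card (verticalPart ρ.ker)) (card_pos.2 ⟨_, add_mem_add h0 h0⟩)
    have hX := card_le_fiberMaxSum (B := B) (g := g)
    have hsum := R.sum_le
    omega

end Cover

section SparseProfile

/-- The sizes `f i` of the fibres of a set over `[0, l]` and `F j` of those of its sumset over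
`[0, 2l]`, for fibres contained in cosets of a group of order `h`, when every fibre of the set has
density below `2 / 3` in its coset. -/
structure IsSparseProfile (f F : ℤ → ℤ) (h l : ℤ) : Prop where
  five_le : 5 ≤ l
  sparse : ∀ i, 0 ≤ i → i ≤ l → 3 * f i < 2 * h
  le_add : ∀ i j, 0 ≤ i → i ≤ l → 0 ≤ j → j ≤ l → f i ≤ F (i + j)
  full : ∀ i j, 0 ≤ i → i ≤ l → 0 ≤ j → j ≤ l → h < f i + f j → h ≤ F (i + j)
  large : l * h + ∑ i ∈ Icc 0 l, f i ≤ ∑ j ∈ Icc 0 (2 * l), F j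
  doubling : 2 * ∑ j ∈ Icc 0 (2 * l), F j < 5 * ∑ i ∈ Icc 0 l, f i

lemma sum_Icc_zero_sub (f : ℤ → ℤ) (n : ℤ) : ∑ i ∈ Icc 0 n, f (n - i) = ∑ i ∈ Icc 0 n, f i :=
  sum_nbij' (n - ·) (n - ·) (fun i hi => by rw [mem_Icc] at *; omega)
    (fun i hi => by rw [mem_Icc] at *; omega) (by simp) (by simp) (by simp)

lemma sum_Icc_zero_eq_add_sum_Icc_three (f : ℤ → ℤ) {n : ℤ} (hn : 5 ≤ n) :
    ∑ i ∈ Icc 0 n, f i = f 0 + f 1 + f 2 + ∑ i ∈ Icc 3 (n - 3), f i +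
      (f n + f (n - 1) + f (n - 2)) := by
  have hunion : Icc 0 n = ({0, 1, 2, n, n - 1, n - 2} : Finset ℤ) ∪ Icc 3 (n - 3) := by
    ext i
    simp only [mem_union, mem_insert, mem_singleton, mem_Icc]
    omega
  have hdisj : Disjoint ({0, 1, 2, n, n - 1, n - 2} : Finset ℤ) (Icc 3 (n - 3)) := by
    rw [disjoint_left]
    simp only [mem_insert, mem_singleton, mem_Icc]
    omega
  rw [hunion, sum_union hdisj]
  repeat rw [sum_insert (by simp only [mem_insert, mem_singleton]; omega)]
  rw [sum_singleton]
  ring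

namespace IsSparseProfile

variable {f F : ℤ → ℤ} {h l : ℤ}

lemma reverse (P : IsSparseProfile f F h l) :
    IsSparseProfile (fun i => f (l - i)) (fun j => F (2 * l - j)) h l where
  five_le := P.five_le
  sparse i hi hil := P.sparse _ (by omega) (by omega)
  le_add i j hi hil hj hjl := by
    rw [show 2 * l - (i + j) = l - i + (l - j) by ring]
    exact P.le_add _ _ (by omega) (by omega) (by omega) (by omega)
  full i j hi hil hj hjl := by
    rw [show 2 * l - (i + j) = l - i + (l - j) by ring]
    exact P.full _ _ (by omega) (by omega) (by omega) (by omega)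
  large := by
    rw [sum_Icc_zero_sub f, sum_Icc_zero_sub F]
    exact P.large
  doubling := by
    rw [sum_Icc_zero_sub f, sum_Icc_zero_sub F]
    exact P.doubling

lemma sum_two_mul_sub_lt (P : IsSparseProfile f F h l) :
    ∑ i ∈ Icc 0 l, (2 * h - 3 * f i) < 2 * h := by
  have hl := P.five_le
  rw [sum_sub_distrib, sum_const, ← mul_sum, Int.card_Icc, sub_zero, nsmul_eq_mul,
    Int.toNat_of_nonneg (by omega)]
  linarith [P.large, P.doubling]

lemma two_mul_sub_nonneg (P : IsSparseProfile f F h l) {i : ℤ} (hi : i ∈ Icc 0 l) :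
    0 ≤ 2 * h - 3 * f i := by
  have hsparse := P.sparse i (mem_Icc.1 hi).1 (mem_Icc.1 hi).2
  omega

lemma nonneg (P : IsSparseProfile f F h l) : 0 ≤ h := by
  have hsum := sum_nonneg fun i => P.two_mul_sub_nonneg (i := i)
  have hlt := P.sum_two_mul_sub_lt
  omega

/- Two disjoint pairs, each of at most `h` elements, would already have deficit `2h`. -/
lemma lt_add_or_lt_add (P : IsSparseProfile f F h l) {a b c d : ℤ} (ha : 0 ≤ a) (hab : a < b)
    (hbc : b < c) (hcd : c < d) (hd : d ≤ l) : h < f a + f d ∨ h < f b + f c := by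
  by_contra! hle
  have hsub : ({a, b, c, d} : Finset ℤ) ⊆ Icc 0 l := by
    intro x hx
    simp only [mem_insert, mem_singleton] at hx
    rw [mem_Icc]
    omega
  have hsum := sum_le_sum_of_subset_of_nonneg hsub fun i hi _ => P.two_mul_sub_nonneg hi
  rw [sum_insert (by simp; omega), sum_insert (by simp; omega), sum_pair (by omega)] at hsum
  have hlt := P.sum_two_mul_sub_lt
  omega

lemma le_of_le (P : IsSparseProfile f F h l) {j : ℤ} (hj : 3 ≤ j) (hjl : j ≤ l) : h ≤ F j := by
  rcases P.lt_add_or_lt_add le_rfl (show (0 : ℤ) < 1 by norm_num) (show 1 < j - 1 by omega)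
    (sub_one_lt j) hjl with hlt | hlt
  · simpa only [zero_add] using P.full 0 j le_rfl (by omega) (by omega) hjl hlt
  · simpa only [add_sub_cancel] using
      P.full 1 (j - 1) (by omega) (by omega) (by omega) (by omega) hlt

lemma le_of_mem_Icc (P : IsSparseProfile f F h l) {j : ℤ} (hj : j ∈ Icc 3 (2 * l - 3)) :
    h ≤ F j := by
  rw [mem_Icc] at hj
  rcases le_total j l with hjl | hlj
  · exact P.le_of_le hj.1 hjl
  · simpa only [sub_sub_cancel] using
      P.reverse.le_of_le (j := 2 * l - j) (by omega) (by omega)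

lemma five_mul_le (P : IsSparseProfile f F h l) :
    5 * (f 0 + f 1 + f 2) ≤ 2 * (F 0 + F 1 + F 2) + 5 * h := by
  have hl := P.five_le
  have h₀ := P.le_add 0 0 le_rfl (by omega) le_rfl (by omega)
  have h₁ := P.le_add 1 0 (by omega) (by omega) le_rfl (by omega)
  have h₂ := P.le_add 2 0 (by omega) (by omega) le_rfl (by omega)
  have h₀₁ := P.full 0 1 le_rfl (by omega) (by omega) (by omega)
  have h₀₂ := P.full 0 2 le_rfl (by omega) (by omega) (by omega)
  have h₁₁ := P.full 1 1 (by omega) (by omega) (by omega) (by omega)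
  have s₀ := P.sparse 0 le_rfl (by omega)
  have s₁ := P.sparse 1 (by omega) (by omega)
  have s₂ := P.sparse 2 (by omega) (by omega)
  norm_num only at h₀ h₁ h₂ h₀₁ h₀₂ h₁₁
  omega

end IsSparseProfile

lemma not_isSparseProfile (f F : ℤ → ℤ) (h l : ℤ) : ¬ IsSparseProfile f F h l := by
  intro P
  have hl := P.five_le
  have hlow := P.five_mul_le
  have hhigh := P.reverse.five_mul_le
  rw [sub_zero, sub_zero] at hhigh
  have hF : (2 * l - 5) * h ≤ ∑ j ∈ Icc 3 (2 * l - 3), F j := by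
    have hsum := card_nsmul_le_sum _ _ _ fun j => P.le_of_mem_Icc (j := j)
    rwa [Int.card_Icc, nsmul_eq_mul, Int.toNat_of_nonneg (by omega),
      show 2 * l - 3 + 1 - 3 = 2 * l - 5 by ring] at hsum
  have hf : 3 * ∑ i ∈ Icc 3 (l - 3), f i ≤ (l - 5) * (2 * h) := by
    rw [mul_sum]
    have hsum := sum_le_card_nsmul (Icc 3 (l - 3)) (fun i => 3 * f i) (2 * h) fun i hi =>
      (P.sparse i (by rw [mem_Icc] at hi; omega) (by rw [mem_Icc] at hi; omega)).le
    rwa [Int.card_Icc, nsmul_eq_mul, Int.toNat_of_nonneg (by omega),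
      show l - 3 + 1 - 3 = l - 5 by ring] at hsum
  have hdbl := P.doubling
  rw [sum_Icc_zero_eq_add_sum_Icc_three f hl,
    sum_Icc_zero_eq_add_sum_Icc_three F (show 5 ≤ 2 * l by omega)] at hdbl
  have hh := mul_nonneg (sub_nonneg.2 hl) P.nonneg
  linarith

end SparseProfile

section LargeFiber

variable {G : Type*} [AddCommGroup G]

variable {B : Finset (ℤ × G)} {g : ℤ × G} {K : AddSubgroup (ℤ × G)}

lemma IsNormalized.image_fst_subset_Icc (hB : IsNormalized B g) :
    B.image Prod.fst ⊆ Icc 0 g.1 := by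
  intro i hi
  obtain ⟨z, hz, rfl⟩ := mem_image.1 hi
  exact mem_Icc.2 ⟨hB.fst_nonneg z hz, hB.fst_le z hz⟩

lemma IsNormalized.sum_card_fiber (hB : IsNormalized B g) :
    ∑ i ∈ Icc 0 g.1, #{z ∈ B | z.1 = i} = #B :=
  (card_eq_sum_card_fiberwise fun _ hz =>
    hB.image_fst_subset_Icc (mem_image_of_mem Prod.fst hz)).symm

lemma card_levels_of_one_mem {x : G} (hx : (1, x) ∈ K) (L : ℤ) :
    #(levels K L) = L.toNat := by
  have hlevels : levels K L = Ico 0 L := by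
    ext i
    rw [mem_levels, mem_Ico, and_iff_left]
    exact ⟨i • x, by simpa using K.zsmul_mem hx i⟩
  rw [hlevels, Int.card_Ico, sub_zero]

variable [DecidableEq G]

/- For `p ∈ c + e + S`, the subsets `X` and `p - Y` of the coset `c + S` cannot be disjoint. -/
lemma natCard_le_card_add_of_lt {S : AddSubgroup G} [Finite S] {X Y : Finset G} {c e : G}
    (hX : ∀ x ∈ X, x - c ∈ S) (hY : ∀ y ∈ Y, y - e ∈ S) (hlt : Nat.card S < #X + #Y) :
    Nat.card S ≤ #(X + Y) := by
  obtain ⟨P, hP, hPcard⟩ := exists_finset_mem_iff_sub_mem S (c + e)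
  rw [← hPcard]
  refine card_le_card fun p hp => ?_
  have hsub : ∀ z ∈ X ∪ Y.image (p - ·), z - c ∈ S := by
    intro z hz
    rcases mem_union.1 hz with hz | hz
    · exact hX z hz
    · obtain ⟨y, hy, rfl⟩ := mem_image.1 hz
      rw [show p - y - c = p - (c + e) - (y - e) by abel]
      exact sub_mem ((hP p).1 hp) (hY y hy)
  have hle := card_le_natCard_of_sub_mem c hsub
  have hunion := card_union_add_card_inter X (Y.image (p - ·))
  rw [card_image_of_injective _ sub_right_injective] at hunion
  obtain ⟨x, hx⟩ : (X ∩ Y.image (p - ·)).Nonempty := card_pos.1 (by omega)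
  obtain ⟨hx, hxy⟩ := mem_inter.1 hx
  obtain ⟨y, hy, rfl⟩ := mem_image.1 hxy
  exact mem_add.2 ⟨_, hx, y, hy, sub_add_cancel _ _⟩

lemma fiber_add_fiber_subset (i j : ℤ) :
    {z ∈ B | z.1 = i} + {z ∈ B | z.1 = j} ⊆ {z ∈ B + B | z.1 = i + j} := by
  intro z hz
  obtain ⟨u, hu, v, hv, rfl⟩ := mem_add.1 hz
  rw [mem_filter] at hu hv ⊢
  exact ⟨add_mem_add hu.1 hv.1, by rw [Prod.fst_add, hu.2, hv.2]⟩

lemma card_fiber_le_card_fiber_add {i j : ℤ} (hj : j ∈ B.image Prod.fst) :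
    #{z ∈ B | z.1 = i} ≤ #{z ∈ B + B | z.1 = i + j} := by
  obtain ⟨w, hw, hwj⟩ := mem_image.1 hj
  have hne : {z ∈ B | z.1 = j}.Nonempty := ⟨w, mem_filter.2 ⟨hw, hwj⟩⟩
  exact (card_le_card_add_right hne).trans (card_le_card (fiber_add_fiber_subset i j))

lemma natCard_verticalPart_le_card_fiber_add [Finite (verticalPart K)]
    (hK : ∀ z ∈ B, z ∈ K) {i j : ℤ} (hi : i ∈ B.image Prod.fst) (hj : j ∈ B.image Prod.fst)
    (hlt : Nat.card (verticalPart K) < #{z ∈ B | z.1 = i} + #{z ∈ B | z.1 = j}) :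
    Nat.card (verticalPart K) ≤ #{z ∈ B + B | z.1 = i + j} := by
  have hsub : ∀ w ∈ B, ∀ y ∈ {z ∈ B | z.1 = w.1}.image Prod.snd, y - w.2 ∈ verticalPart K := by
    intro w hw y hy
    obtain ⟨z, hz, rfl⟩ := mem_image.1 hy
    obtain ⟨hz, hzw⟩ := mem_filter.1 hz
    rw [mem_verticalPart, ← sub_eq_zero.2 hzw]
    exact sub_mem (hK z hz) (hK w hw)
  have hcard : ∀ k, #({z ∈ B | z.1 = k}.image Prod.snd) = #{z ∈ B | z.1 = k} := fun k =>
    card_image_of_injOn fun u hu v hv huv =>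
      Prod.ext ((mem_filter.1 hu).2.trans (mem_filter.1 hv).2.symm) huv
  rw [← hcard i, ← hcard j] at hlt
  obtain ⟨u, hu, rfl⟩ := mem_image.1 hi
  obtain ⟨v, hv, rfl⟩ := mem_image.1 hj
  refine (natCard_le_card_add_of_lt (hsub u hu) (hsub v hv) hlt).trans ?_
  have himage : ({z ∈ B | z.1 = u.1} + {z ∈ B | z.1 = v.1}).image Prod.snd =
      {z ∈ B | z.1 = u.1}.image Prod.snd + {z ∈ B | z.1 = v.1}.image Prod.snd :=
    image_add (AddMonoidHom.snd ℤ G)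
  rw [← himage]
  exact card_image_le.trans (card_le_card (fiber_add_fiber_subset _ _))

lemma IsNormalized.image_fst_eq_Icc (hB : IsNormalized B g) {h : ℕ}
    (hcard : g.1 * h + #B ≤ #(B + B)) (hdbl : 2 * #(B + B) < 5 * #B)
    (hsparse : ∀ i ∈ B.image Prod.fst, 3 * #{z ∈ B | z.1 = i} ≤ 2 * h) :
    B.image Prod.fst = Icc 0 g.1 := by
  refine eq_of_subset_of_card_le hB.image_fst_subset_Icc ?_
  have hle : 3 * #B ≤ #(B.image Prod.fst) * (2 * h) := by
    rw [card_eq_sum_card_image Prod.fst B, mul_sum]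
    exact sum_le_card_nsmul _ _ _ hsparse
  have hlt : g.1 < #(B.image Prod.fst) := by
    refine lt_of_mul_lt_mul_right (a := 2 * (h : ℤ)) ?_ (by positivity)
    zify at hle hdbl
    linarith
  rw [Int.card_Icc]
  omega

lemma IsNormalized.sum_card_fiber_add (hB : IsNormalized B g) :
    ∑ j ∈ Icc 0 (2 * g.1), #{z ∈ B + B | z.1 = j} = #(B + B) := by
  refine (card_eq_sum_card_fiberwise fun z hz => ?_).symm
  obtain ⟨u, hu, v, hv, rfl⟩ := mem_add.1 hz
  have hu₀ := hB.fst_nonneg u hu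
  have hv₀ := hB.fst_nonneg v hv
  have hug := hB.fst_le u hu
  have hvg := hB.fst_le v hv
  rw [Prod.fst_add, mem_coe, mem_Icc]
  omega

theorem IsNormalized.exists_two_mul_natCard_le (hB : IsNormalized B g)
    (hsix : 6 ≤ #(B.image Prod.fst)) [Finite (verticalPart K)] (hK : ∀ z ∈ B, z ∈ K)
    (hcard : g.1 * Nat.card (verticalPart K) + #B ≤ #(B + B)) (hdbl : 2 * #(B + B) < 5 * #B) :
    ∃ i, 2 * Nat.card (verticalPart K) ≤ 3 * #{z ∈ B | z.1 = i} := by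
  by_contra! hsparse
  have himage := hB.image_fst_eq_Icc hcard hdbl fun i _ => (hsparse i).le
  have hmem : ∀ i, 0 ≤ i → i ≤ g.1 → i ∈ B.image Prod.fst := fun i h₀ h₁ => by
    rw [himage]
    exact mem_Icc.2 ⟨h₀, h₁⟩
  refine not_isSparseProfile (fun i => #{z ∈ B | z.1 = i}) (fun j => #{z ∈ B + B | z.1 = j})
    (Nat.card (verticalPart K)) g.1 ⟨?_, fun i _ _ => mod_cast hsparse i,
      fun i j _ _ h₀ h₁ => mod_cast card_fiber_le_card_fiber_add (hmem j h₀ h₁),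
      fun i j hi₀ hi₁ hj₀ hj₁ hlt => ?_, ?_, ?_⟩
  · rw [himage, Int.card_Icc] at hsix
    omega
  · exact mod_cast natCard_verticalPart_le_card_fiber_add hK (hmem i hi₀ hi₁) (hmem j hj₀ hj₁)
      (mod_cast hlt)
  · rw [← Nat.cast_sum, ← Nat.cast_sum, hB.sum_card_fiber, hB.sum_card_fiber_add]
    exact hcard
  · rw [← Nat.cast_sum, ← Nat.cast_sum, hB.sum_card_fiber, hB.sum_card_fiber_add]
    exact mod_cast hdbl

end LargeFiber

section Structure

variable {G : Type*} [AddCommGroup G] {K : AddSubgroup (ℤ × G)}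

/- The first coordinates of `K` form a subgroup of `ℤ`, generated by a divisor of all `a i`. -/
lemma exists_one_mem_of_gcd_eq_one {ι : Type*} {s : Finset ι} {a : ι → ℤ} (hgcd : s.gcd a = 1)
    (hK : ∀ i ∈ s, ∃ x, (a i, x) ∈ K) : ∃ x, (1, x) ∈ K := by
  obtain ⟨n, hn⟩ := Int.subgroup_cyclic (K.map (AddMonoidHom.fst ℤ G))
  have hmem : ∀ {m : ℤ}, m ∈ K.map (AddMonoidHom.fst ℤ G) ↔ n ∣ m := by
    rw [hn, ← AddSubgroup.zmultiples_eq_closure]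
    exact Int.mem_zmultiples_iff
  have hdvd : n ∣ s.gcd a := dvd_gcd fun i hi => by
    obtain ⟨x, hx⟩ := hK i hi
    exact hmem.1 ⟨_, hx, rfl⟩
  obtain ⟨⟨_, x⟩, hx, rfl⟩ := hmem.2 (hgcd ▸ hdvd)
  exact ⟨x, hx⟩

lemma card_le_card_image_fst_mul {U : Finset (ℤ × G)} {H : AddSubgroup G} [Finite H] (c : ℤ → G)
    (hU : ∀ u ∈ U, u.2 - c u.1 ∈ H) : #U ≤ #(U.image Prod.fst) * Nat.card H := by
  classical
  rw [mul_comm]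
  refine card_le_mul_card_image U _ fun i _ => ?_
  have hinj : Set.InjOn Prod.snd ({u ∈ U | u.1 = i} : Set (ℤ × G)) := fun u hu v hv huv =>
    Prod.ext (hu.2.trans hv.2.symm) huv
  rw [← card_image_of_injOn (hinj.mono fun u hu => mem_filter.1 hu)]
  refine card_le_natCard_of_sub_mem (c i) fun x hx => ?_
  obtain ⟨u, hu, rfl⟩ := mem_image.1 hx
  obtain ⟨hu, hui⟩ := mem_filter.1 hu
  rw [← hui]
  exact hU u hu

variable [DecidableEq G] {U : Finset (ℤ × G)}

lemma exists_isNormalized_neg_vadd (hU : 1 < #(U.image Prod.fst)) :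
    ∃ u ∈ U, ∃ g, IsNormalized (-u +ᵥ U) g ∧ ∀ v ∈ U, ∀ w ∈ U, v.1 - w.1 ≤ g.1 := by
  have hne : U.Nonempty := image_nonempty.1 (card_pos.1 (zero_lt_one.trans hU))
  obtain ⟨u, hu, hmin⟩ := exists_min_image U Prod.fst hne
  obtain ⟨t, ht, hmax⟩ := exists_max_image U Prod.fst hne
  have hmem : ∀ z, z ∈ -u +ᵥ U ↔ u + z ∈ U := fun z => mem_neg_vadd_finset_iff
  have hlt : u.1 < t.1 := by
    obtain ⟨i, hi, j, hj, hij⟩ := one_lt_card.1 hU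
    obtain ⟨v, hv, rfl⟩ := mem_image.1 hi
    obtain ⟨w, hw, rfl⟩ := mem_image.1 hj
    have := hmin v hv
    have := hmin w hw
    have := hmax v hv
    have := hmax w hw
    omega
  refine ⟨u, hu, t - u, ⟨?_, ?_, fun z hz => ?_, fun z hz => ?_, sub_pos.2 hlt⟩,
    fun v hv w hw => sub_le_sub (hmax v hv) (hmin w hw)⟩
  · rwa [hmem, add_zero]
  · rwa [hmem, add_sub_cancel]
  · exact le_add_iff_nonneg_right _ |>.1 (hmin _ ((hmem z).1 hz))
  · exact le_sub_iff_add_le'.2 (hmax _ ((hmem z).1 hz))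

lemma card_fiber_neg_vadd (u : ℤ × G) (i : ℤ) :
    #{z ∈ -u +ᵥ U | z.1 = i} = #{z ∈ U | z.1 = u.1 + i} := by
  rw [← card_vadd_finset (-u) {z ∈ U | z.1 = u.1 + i}]
  congr 1
  ext z
  simp only [mem_filter, mem_neg_vadd_finset_iff, vadd_eq_add, Prod.fst_add, add_right_inj]

lemma card_image_fst_neg_vadd (u : ℤ × G) :
    #((-u +ᵥ U).image Prod.fst) = #(U.image Prod.fst) := by
  rw [← card_vadd_finset (-u.1) (U.image Prod.fst)]
  congr 1
  exact image_vadd_distrib (AddMonoidHom.fst ℤ G) (-u) U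

theorem exists_addSubgroup_of_gcd_sub_eq_one (hsix : 6 ≤ #(U.image Prod.fst))
    (hdbl : 2 * #(U + U) < 5 * #U) (hgcd : (U - U).gcd Prod.fst = 1) :
    ∃ (H : AddSubgroup G) (x y : G), Finite H ∧ (∀ u ∈ U, u.2 - (u.1 • x + y) ∈ H) ∧
      (∃ i, 2 * Nat.card H ≤ 3 * #{z ∈ U | z.1 = i}) ∧
      ∀ u ∈ U, ∀ v ∈ U, (u.1 - v.1) * Nat.card H + #U ≤ #(U + U) := by
  obtain ⟨t, ht, g, hB, hg⟩ := exists_isNormalized_neg_vadd (U := U) (by omega)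
  have hadd : #((-t +ᵥ U) + (-t +ᵥ U)) = #(U + U) := by
    rw [vadd_add_vadd_comm, card_vadd_finset]
  rw [← card_image_fst_neg_vadd t] at hsix
  rw [← hadd, ← card_vadd_finset (-t) U] at hdbl
  obtain ⟨K, hfin, hK, hcard⟩ := hB.exists_addSubgroup hsix hdbl
  have hKt : ∀ u ∈ U, u - t ∈ K := fun u hu => by
    rw [← neg_add_eq_sub]
    exact hK _ (vadd_mem_vadd_finset hu)
  obtain ⟨x, hx⟩ := exists_one_mem_of_gcd_eq_one hgcd fun z hz => by
    obtain ⟨u, hu, v, hv, rfl⟩ := mem_sub.1 hz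
    refine ⟨(u - v).2, ?_⟩
    rw [Prod.mk.eta, ← sub_sub_sub_cancel_right u v t]
    exact K.sub_mem (hKt u hu) (hKt v hv)
  rw [card_levels_of_one_mem hx] at hcard
  zify at hcard
  rw [Int.toNat_of_nonneg hB.fst_pos.le] at hcard
  obtain ⟨i, hi⟩ := hB.exists_two_mul_natCard_le hsix hK hcard hdbl
  rw [card_fiber_neg_vadd] at hi
  rw [hadd, card_vadd_finset] at hcard
  refine ⟨verticalPart K, x, t.2 - t.1 • x, hfin, fun u hu => ?_, ⟨_, hi⟩, fun u hu v hv => ?_⟩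
  · have hsub := K.sub_mem (hKt u hu) (K.zsmul_mem hx (u.1 - t.1))
    rw [mem_verticalPart]
    convert hsub using 1
    ext
    · simp
    · simp only [Prod.snd_sub, Prod.smul_snd, sub_smul]
      abel
  · have hh : (0 : ℤ) ≤ Nat.card (verticalPart K) := Nat.cast_nonneg _
    linarith [mul_le_mul_of_nonneg_right (hg u hu v hv) hh]

end Structure

section Indexed

variable {ι G : Type*} [Fintype ι] [DecidableEq G]

/-- The set `⋃ i, {a i} × B i` in `ℤ × G`: the analogue of `fiberUnion` for an arbitrary group and
an arbitrary finite index type. -/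
def indexedFiberUnion (a : ι → ℤ) (B : ι → Finset G) : Finset (ℤ × G) :=
  univ.biUnion fun i => {a i} ×ˢ B i

variable {a : ι → ℤ} {B : ι → Finset G}

lemma mem_indexedFiberUnion {z : ℤ × G} :
    z ∈ indexedFiberUnion a B ↔ ∃ i, z.1 = a i ∧ z.2 ∈ B i := by
  simp only [indexedFiberUnion, mem_biUnion, mem_univ, true_and, mem_product, mem_singleton]

lemma mk_mem_indexedFiberUnion {i : ι} {w : G} (hw : w ∈ B i) :
    (a i, w) ∈ indexedFiberUnion a B :=
  mem_indexedFiberUnion.2 ⟨i, rfl, hw⟩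

lemma card_image_fst_indexedFiberUnion (ha : Function.Injective a) (hB : ∀ i, (B i).Nonempty) :
    #((indexedFiberUnion a B).image Prod.fst) = Fintype.card ι := by
  rw [← card_univ, ← card_image_of_injective univ ha]
  congr 1
  ext n
  simp only [mem_image, mem_univ, true_and]
  constructor
  · rintro ⟨z, hz, rfl⟩
    obtain ⟨i, hi, -⟩ := mem_indexedFiberUnion.1 hz
    exact ⟨i, hi.symm⟩
  · rintro ⟨i, rfl⟩
    obtain ⟨w, hw⟩ := hB i
    exact ⟨(a i, w), mk_mem_indexedFiberUnion hw, rfl⟩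

lemma card_fiber_indexedFiberUnion (ha : Function.Injective a) (i : ι) :
    #{z ∈ indexedFiberUnion a B | z.1 = a i} = #(B i) := by
  rw [← one_mul #(B i), ← card_singleton (a i), ← card_product]
  congr 1
  ext z
  rw [mem_filter, mem_indexedFiberUnion, mem_product, mem_singleton, and_comm]
  refine and_congr_right fun hz => ⟨?_, fun h => ⟨i, hz, h⟩⟩
  rintro ⟨j, hj, hzj⟩
  rwa [ha (hz.symm.trans hj)]

lemma gcd_fst_sub_indexedFiberUnion [AddCommGroup G] {i₀ : ι} (hB : ∀ i, (B i).Nonempty)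
    (hgcd : univ.gcd (fun i => a i - a i₀) = 1) :
    (indexedFiberUnion a B - indexedFiberUnion a B).gcd Prod.fst = 1 := by
  rw [← Finset.normalize_gcd, normalize_eq_one, isUnit_iff_dvd_one, ← hgcd]
  refine dvd_gcd fun i _ => ?_
  obtain ⟨v, hv⟩ := hB i
  obtain ⟨w, hw⟩ := hB i₀
  exact gcd_dvd (f := Prod.fst)
    (sub_mem_sub (mk_mem_indexedFiberUnion (a := a) hv) (mk_mem_indexedFiberUnion hw))

end Indexed

theorem theorem5_general {ι G : Type*} [Fintype ι] [AddCommGroup G] [DecidableEq G]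
    (hι : 6 ≤ Fintype.card ι) (a : ι → ℤ) (ha : Function.Injective a) (i₀ : ι)
    (hgcd : univ.gcd (fun i => a i - a i₀) = 1) (B : ι → Finset G) (hB : ∀ i, (B i).Nonempty)
    (hdoubling : (#(indexedFiberUnion a B + indexedFiberUnion a B) : ℝ) <
      5 / 2 * #(indexedFiberUnion a B)) :
    (∀ i j, (a i - a j : ℝ) < 3 / 2 * Fintype.card ι) ∧
    ∃ H : AddSubgroup G, Finite H ∧
      (∃ x y : G, ∀ i, (B i : Set G) ⊆ (a i • x + y) +ᵥ (H : Set G)) ∧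
      (∃ j, 2 / 3 * (Nat.card H : ℝ) ≤ #(B j)) ∧
      ∀ i j, (a i - a j) * (Nat.card H : ℤ) ≤
        #(indexedFiberUnion a B + indexedFiberUnion a B) - #(indexedFiberUnion a B) := by
  set U := indexedFiberUnion a B
  have himage : #(U.image Prod.fst) = Fintype.card ι := card_image_fst_indexedFiberUnion ha hB
  have hdbl : 2 * #(U + U) < 5 * #U := by
    have : 2 * (#(U + U) : ℝ) < 5 * #U := by linarith
    exact_mod_cast this
  obtain ⟨H, x, y, hfin, hcoset, ⟨n, hn⟩, hle⟩ :=
    exists_addSubgroup_of_gcd_sub_eq_one (himage ▸ hι) hdbl (gcd_fst_sub_indexedFiberUnion hB hgcd)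
  have hHpos : 0 < Nat.card H := Nat.card_pos
  have hgap : ∀ i j, (a i - a j) * Nat.card H + #U ≤ #(U + U) := fun i j => by
    obtain ⟨v, hv⟩ := hB i
    obtain ⟨w, hw⟩ := hB j
    exact hle _ (mk_mem_indexedFiberUnion hv) _ (mk_mem_indexedFiberUnion hw)
  have hUcard : #U ≤ Fintype.card ι * Nat.card H :=
    himage ▸ card_le_card_image_fst_mul (fun n => n • x + y) hcoset
  refine ⟨fun i j => ?_, H, hfin, ⟨x, y, fun i w hw => ?_⟩, ?_,
    fun i j => le_sub_iff_add_le.2 (hgap i j)⟩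
  · have hlt : 2 * (a i - a j) < 3 * Fintype.card ι := by
      refine lt_of_mul_lt_mul_right (a := (Nat.card H : ℤ)) ?_ (Nat.cast_nonneg _)
      zify at hUcard hdbl
      linarith [hgap i j]
    have : 2 * (a i - a j : ℝ) < 3 * Fintype.card ι := mod_cast hlt
    linarith
  · exact Set.mem_vadd_set.2 ⟨_, hcoset _ (mk_mem_indexedFiberUnion hw), add_sub_cancel _ _⟩
  · obtain ⟨z, hz⟩ : {z ∈ U | z.1 = n}.Nonempty := card_pos.1 (by omega)
    obtain ⟨hzU, rfl⟩ := mem_filter.1 hz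
    obtain ⟨j, hj, -⟩ := mem_indexedFiberUnion.1 hzU
    rw [hj, card_fiber_indexedFiberUnion ha] at hn
    have : 2 * (Nat.card H : ℝ) ≤ 3 * #(B j) := mod_cast hn
    exact ⟨j, by linarith⟩

theorem theorem5 (s d : ℕ) (hs : 6 ≤ s) (hd : 0 < d)
    (a : Fin s → ℤ) (ha : Function.Injective a) (ha₁ : a ⟨0, by omega⟩ = 0)
    (hgcd : (Finset.univ.filter fun i => a i ≠ 0).gcd a = 1)
    (B : Fin s → Finset (ZMod d)) (hB : ∀ i, (B i).Nonempty)
    (hB₁ : (0 : ZMod d) ∈ B ⟨0, by omega⟩)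
    (hdoubling : ((fiberUnion a B + fiberUnion a B).card : ℝ)
      < 5 / 2 * ((fiberUnion a B).card : ℝ))
    (M : ℤ) (hM : IsGreatest (Set.range a) M) :
    (M : ℝ) < 3 / 2 * (s : ℝ) ∧
    ∃ H : AddSubgroup (ZMod d),
      (∃ x y : ZMod d, ∀ i, (B i : Set (ZMod d)) ⊆ (a i • x + y) +ᵥ (H : Set (ZMod d))) ∧
      (∃ j, 2 / 3 * (Nat.card H : ℝ) ≤ ((B j).card : ℝ)) ∧
      M * (Nat.card H : ℤ)
        ≤ ((fiberUnion a B + fiberUnion a B).card : ℤ) - ((fiberUnion a B).card : ℤ) := by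
  obtain ⟨⟨k, rfl⟩, -⟩ := hM
  rw [← gcd_eq_gcd_filter_ne_zero] at hgcd
  rw [show fiberUnion a B = indexedFiberUnion a B from rfl] at hdoubling ⊢
  obtain ⟨hlt, H, -, hcoset, hlarge, hle⟩ := theorem5_general (by rwa [Fintype.card_fin]) a ha
    ⟨0, by omega⟩ (by simpa only [ha₁, sub_zero] using hgcd) B hB hdoubling
  exact ⟨by simpa [ha₁] using hlt k ⟨0, by omega⟩, H, hcoset, hlarge,
    by simpa only [ha₁, sub_zero] using hle k ⟨0, by omega⟩⟩
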